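/- Let $\theta\in[0,1)$ be irrational and let $\mathcal A_\theta$ be the irrational rotation algebra, i.e. the universal $C^*$-algebra generated by two unitaries $U,V$ with $VU=e^{2\pi i\theta}UV$. Then $\mathcal A_\theta$ itself (not only its matrix algebras) contains projections representing infinitely many different classes of $K_0(\mathcal A_\theta)$: the set $\{[p]\in K_0(\mathcal A_\theta) : p\in\mathcal A_\theta,\ p=p^*=p^2\}$ is infinite. More precisely, there is a canonical trace on $\mathcal A_\theta$, i.e. a bounded linear functional $\tau$ with $\tau(U^m a(V))=\delta_{m,0}\int_0^1 a(x)\,dx$ for all $m\in\mathbb Z$ and all continuous $1$-periodic $a:\mathbb R\to\mathbb C$ (where $a(V)$ is given by the functional calculus sending $x\mapsto e^{2\pi i x}$ to $V$), such that projections $p,q\in\mathcal A_\theta$ with $\tau(p)\ne\tau(q)$ have $[p]\neq[q]$ in $K_0(\mathcal A_\theta)$, and for every integer $M\ge1$ there is a projection $p\in\mathcal A_\theta$ of Power–Rieffel type of order $M$ with $\tau(p)=M\theta-\lfloor M\theta\rfloor$. Here "Power–Rieffel type of order $M$" means $$p=U^{-M}p_M(x-M\theta)\big|_{V}+p_0(V)+U^M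 p_M(V),$$ where the vertical bar means evaluating the function of $x$ at $V$ as above, and where, with $\theta'=M\theta-\lfloor M\theta\rfloor$, for some $\varepsilon>0$ with $\varepsilon<\theta'$ and $\varepsilon+\theta'<1$ and some continuous $d:[0,\varepsilon]\to[0,1]$ with $d(0)=0$, $d(\varepsilon)=1$, the functions $p_0,p_M$ are $1$-periodic and given on $[0,1)$ by $p_0=d(x)$ on $[0,\varepsilon]$, $p_0=1$ on $(\varepsilon,\theta')$, $p_0=1-d(x-\theta')$ on $[\theta',\theta'+\varepsilon]$, $p_0=0$ on $(\theta'+\varepsilon,1)$; and $p_M=\sqrt{d(x)(1-d(x))}$ on $[0,\varepsilon]$, $p_M=0$ on $(\varepsilon,1)$. -/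

import Mathlib

noncomputable section

/-- The free unital complex `*`-algebra on two unitaries: the group algebra of the free group on two
letters, with `(∑ c_g g)^* = ∑ conj(c_g) g⁻¹`. It is tagged with the parameter `θ` that determines
the seminorm put on it below. -/
def PreTorus (_θ : ℝ) : Type := MonoidAlgebra ℂ (FreeGroup (Fin 2))

namespace PreTorus

variable {θ : ℝ}

instance : Ring (PreTorus θ) := inferInstanceAs (Ring (MonoidAlgebra ℂ (FreeGroup (Fin 2))))

instance : Algebra ℂ (PreTorus θ) :=
  inferInstanceAs (Algebra ℂ (MonoidAlgebra ℂ (FreeGroup (Fin 2))))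

/-- The group element `g` as an element of the group algebra. -/
def word (θ : ℝ) : FreeGroup (Fin 2) →* PreTorus θ := MonoidAlgebra.of ℂ (FreeGroup (Fin 2))

theorem induction {P : PreTorus θ → Prop} (x : PreTorus θ) (h0 : P 0)
    (hadd : ∀ x y, P x → P y → P (x + y)) (hw : ∀ (c : ℂ) g, P (c • word θ g)) : P x := by
  refine MonoidAlgebra.induction_linear (motive := P) x h0 (fun f g => hadd f g) ?_
  intro g c
  have h : (c • MonoidAlgebra.single g (1 : ℂ) : MonoidAlgebra ℂ (FreeGroup (Fin 2))) =
      MonoidAlgebra.single g c := by simp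
  exact h ▸ hw c g

/-- The conjugate-linear involution, as an additive map. -/
def starHom (θ : ℝ) : PreTorus θ →+ PreTorus θ where
  toFun x := MonoidAlgebra.coeff x |>.sum fun g c => (starRingEnd ℂ c) • word θ g⁻¹
  map_zero' := Finsupp.sum_zero_index
  map_add' x y := Finsupp.sum_add_index' (f := MonoidAlgebra.coeff x) (g := MonoidAlgebra.coeff y)
    (h := fun g c => (starRingEnd ℂ c) • word θ g⁻¹)
    (fun g => by rw [map_zero, zero_smul])
    (fun g c d => by rw [map_add, add_smul])

theorem starHom_word (c : ℂ) (g : FreeGroup (Fin 2)) :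
    starHom θ (c • word θ g) = (starRingEnd ℂ c) • word θ g⁻¹ := by
  have h : c • word θ g = (MonoidAlgebra.single g c : MonoidAlgebra ℂ (FreeGroup (Fin 2))) :=
    (by simp : (c • MonoidAlgebra.single g (1 : ℂ) : MonoidAlgebra ℂ (FreeGroup (Fin 2))) = _)
  rw [h]
  exact Finsupp.sum_single_index (a := g) (b := c)
    (h := fun g c => (starRingEnd ℂ c) • word θ g⁻¹) (by rw [map_zero, zero_smul])

instance : StarRing (PreTorus θ) where
  star := starHom θ
  star_involutive x := by
    induction x using induction with
    | h0 => simp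
    | hadd x y hx hy => simp only [map_add, hx, hy]
    | hw c g => simp [starHom_word]
  star_add := map_add _
  star_mul x y := by
    change starHom θ (x * y) = starHom θ y * starHom θ x
    induction x using induction with
    | h0 => simp
    | hadd x x' hx hx' => simp only [map_add, add_mul, mul_add, hx, hx']
    | hw c g =>
      induction y using induction with
      | h0 => simp
      | hadd x x' hx hx' => simp only [map_add, add_mul, mul_add, hx, hx']
      | hw d h =>
        rw [smul_mul_smul_comm, ← map_mul, starHom_word, starHom_word, starHom_word,
          smul_mul_smul_comm, ← map_mul (word θ), mul_inv_rev, map_mul (starRingEnd ℂ),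
          mul_comm (starRingEnd ℂ c)]

theorem star_word (g : FreeGroup (Fin 2)) : star (word θ g) = word θ g⁻¹ := by
  change starHom θ (word θ g) = _
  simpa using starHom_word (θ := θ) 1 g

instance : StarModule ℂ (PreTorus θ) where
  star_smul c x := by
    change starHom θ (c • x) = starRingEnd ℂ c • starHom θ x
    induction x using induction with
    | h0 => simp
    | hadd x x' hx hx' => simp only [map_add, smul_add, hx, hx']
    | hw d g => simp only [starHom_word, smul_smul, map_mul]

/-- The first free unitary generator. -/
def u (θ : ℝ) : PreTorus θ := word θ (FreeGroup.of 0)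

/-- The second free unitary generator. -/
def v (θ : ℝ) : PreTorus θ := word θ (FreeGroup.of 1)

/-- `C^*`-seminorms that kill the relation `V U = e^{2 π i θ} U V`. -/
structure IsTorusSeminorm (θ : ℝ) (s : Seminorm ℂ (PreTorus θ)) : Prop where
  mul_le : ∀ x y, s (x * y) ≤ s x * s y
  star_mul_self : ∀ x, s (star x * x) = s x ^ 2
  rel : s (v θ * u θ - Complex.exp (2 * Real.pi * Complex.I * θ) • (u θ * v θ)) = 0

namespace IsTorusSeminorm

variable {s : Seminorm ℂ (PreTorus θ)}

theorem word_le (hs : IsTorusSeminorm θ s) (g : FreeGroup (Fin 2)) : s (word θ g) ≤ 1 := by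
  have h1 : s 1 ≤ 1 := by
    have := hs.star_mul_self 1
    simp only [star_one, mul_one] at this
    nlinarith [apply_nonneg s 1]
  have h2 := hs.star_mul_self (word θ g)
  rw [star_word, ← map_mul, inv_mul_cancel, map_one] at h2
  nlinarith [apply_nonneg s (word θ g)]

theorem bound (x : PreTorus θ) : ∃ C, ∀ s : {s // IsTorusSeminorm θ s}, s.1 x ≤ C := by
  induction x using induction with
  | h0 => exact ⟨0, by simp⟩
  | hadd x y hx hy =>
    obtain ⟨C, hC⟩ := hx
    obtain ⟨D, hD⟩ := hy
    exact ⟨C + D, fun s => (map_add_le_add s.1 x y).trans (add_le_add (hC s) (hD s))⟩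
  | hw c g =>
    refine ⟨‖c‖, fun s => ?_⟩
    rw [map_smul_eq_mul]
    exact mul_le_of_le_one_right (norm_nonneg _) (s.2.word_le g)

theorem star_eq (hs : IsTorusSeminorm θ s) (x : PreTorus θ) : s (star x) = s x := by
  have key : ∀ y, s y ≤ s (star y) := by
    intro y
    have h1 := hs.star_mul_self y
    have h2 := hs.mul_le (star y) y
    rcases (apply_nonneg s y).eq_or_lt with h | h
    · rw [← h]; exact apply_nonneg _ _
    · nlinarith
  exact le_antisymm (by simpa using key (star x)) (key x)

end IsTorusSeminorm

instance : Nonempty {s // IsTorusSeminorm θ s} :=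
  ⟨⟨0, ⟨by simp, by simp, by simp⟩⟩⟩

theorem bddAbove (x : PreTorus θ) :
    BddAbove (Set.range fun s : {s // IsTorusSeminorm θ s} => s.1 x) := by
  obtain ⟨C, hC⟩ := IsTorusSeminorm.bound x
  exact ⟨C, by rintro _ ⟨s, rfl⟩; exact hC s⟩

/-- The universal `C^*`-seminorm: the supremum of all `C^*`-seminorms that kill the relation. -/
def univNorm (θ : ℝ) (x : PreTorus θ) : ℝ := ⨆ s : {s // IsTorusSeminorm θ s}, s.1 x

theorem le_univNorm (s : {s // IsTorusSeminorm θ s}) (x : PreTorus θ) : s.1 x ≤ univNorm θ x :=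
  le_ciSup (bddAbove x) s

theorem univNorm_nonneg (x : PreTorus θ) : 0 ≤ univNorm θ x :=
  Real.iSup_nonneg fun s => apply_nonneg s.1 x

instance : SeminormedRing (PreTorus θ) :=
  let N : AddGroupSeminorm (PreTorus θ) :=
    { toFun := univNorm θ
      map_zero' := by simp [univNorm]
      add_le' := fun x y => ciSup_le fun s =>
        (map_add_le_add s.1 x y).trans (add_le_add (le_univNorm s x) (le_univNorm s y))
      neg' := fun x => by simp [univNorm] }
  { (inferInstance : Ring (PreTorus θ)), N.toSeminormedAddCommGroup with
    norm_mul_le := fun x y => ciSup_le fun s => (s.2.mul_le x y).trans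
      (mul_le_mul (le_univNorm s x) (le_univNorm s y) (apply_nonneg _ _) (univNorm_nonneg x)) }

theorem norm_def (x : PreTorus θ) : ‖x‖ = ⨆ s : {s // IsTorusSeminorm θ s}, s.1 x := rfl

instance : NormedAlgebra ℂ (PreTorus θ) where
  norm_smul_le c x := by
    refine ciSup_le fun s => ?_
    rw [map_smul_eq_mul]
    exact mul_le_mul_of_nonneg_left (le_univNorm s x) (norm_nonneg c)

instance : NormedStarGroup (PreTorus θ) where
  norm_star_le x := ciSup_le fun s => by rw [s.2.star_eq]; exact le_univNorm s x

theorem norm_mul_self_le (x : PreTorus θ) : ‖x‖ * ‖x‖ ≤ ‖star x * x‖ := by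
  have h : ‖x‖ ≤ Real.sqrt ‖star x * x‖ := by
    refine ciSup_le fun s => Real.le_sqrt_of_sq_le ?_
    rw [← s.2.star_mul_self]
    exact le_univNorm s _
  calc ‖x‖ * ‖x‖ ≤ Real.sqrt ‖star x * x‖ * Real.sqrt ‖star x * x‖ :=
        mul_self_le_mul_self (norm_nonneg x) h
    _ = ‖star x * x‖ := Real.mul_self_sqrt (norm_nonneg _)

theorem norm_rel :
    ‖v θ * u θ - Complex.exp (2 * Real.pi * Complex.I * θ) • (u θ * v θ)‖ = 0 := by
  simp [norm_def, fun s : {s // IsTorusSeminorm θ s} => s.2.rel]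

end PreTorus

open UniformSpace in
/-- The universal `C^*`-algebra generated by unitaries `U`, `V` with `V U = e^{2 π i θ} U V`: the
Hausdorff completion of the free `*`-algebra for the universal `C^*`-seminorm. -/
def NCTorus (θ : ℝ) : Type := Completion (PreTorus θ)

namespace NCTorus

open UniformSpace

variable {θ : ℝ}

instance : NormedRing (NCTorus θ) := inferInstanceAs (NormedRing (Completion (PreTorus θ)))
instance : CompleteSpace (NCTorus θ) := inferInstanceAs (CompleteSpace (Completion (PreTorus θ)))
instance : NormedSpace ℂ (NCTorus θ) :=
  inferInstanceAs (NormedSpace ℂ (Completion (PreTorus θ)))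

/-- The canonical map from the free `*`-algebra; its range is dense. -/
def ofPre (θ : ℝ) (x : PreTorus θ) : NCTorus θ := (x : Completion (PreTorus θ))

theorem denseRange_ofPre : DenseRange (ofPre θ) := Completion.denseRange_coe

theorem norm_ofPre (x : PreTorus θ) : ‖ofPre θ x‖ = ‖x‖ := Completion.norm_coe x
theorem ofPre_mul (x y : PreTorus θ) : ofPre θ (x * y) = ofPre θ x * ofPre θ y :=
  Completion.coe_mul x y
theorem ofPre_add (x y : PreTorus θ) : ofPre θ (x + y) = ofPre θ x + ofPre θ y :=
  Completion.coe_add x y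
theorem ofPre_sub (x y : PreTorus θ) : ofPre θ (x - y) = ofPre θ x - ofPre θ y :=
  Completion.coe_sub x y
theorem ofPre_one : ofPre θ 1 = 1 := rfl
theorem ofPre_smul (c : ℂ) (x : PreTorus θ) : ofPre θ (c • x) = c • ofPre θ x :=
  Completion.coe_smul c x
theorem continuous_ofPre : Continuous (ofPre θ) := Completion.continuous_coe _

theorem ind {P : NCTorus θ → Prop} (hc : IsClosed {x | P x}) (h : ∀ x, P (ofPre θ x))
    (x : NCTorus θ) : P x := Completion.induction_on x hc h

theorem ind₂ {P : NCTorus θ → NCTorus θ → Prop} (hc : IsClosed {x : NCTorus θ × NCTorus θ | P x.1 x.2})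
    (h : ∀ x y, P (ofPre θ x) (ofPre θ y)) (x y : NCTorus θ) : P x y :=
  Completion.induction_on₂ x y hc h

theorem smul_mul_aux (r : ℂ) (x y : NCTorus θ) : r • x * y = r • (x * y) := by
  refine ind₂ (P := fun x y => r • x * y = r • (x * y))
    (isClosed_eq ((continuous_fst.const_smul r).mul continuous_snd)
      (continuous_mul.const_smul r)) (fun x y => ?_) x y
  simp only [← ofPre_smul, ← ofPre_mul, smul_mul_assoc]

theorem mul_smul_aux (r : ℂ) (x y : NCTorus θ) : x * r • y = r • (x * y) := by
  refine ind₂ (P := fun x y => x * r • y = r • (x * y))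
    (isClosed_eq (continuous_fst.mul (continuous_snd.const_smul r))
      (continuous_mul.const_smul r)) (fun x y => ?_) x y
  simp only [← ofPre_smul, ← ofPre_mul, mul_smul_comm]

instance : Algebra ℂ (NCTorus θ) := Algebra.ofModule smul_mul_aux mul_smul_aux

instance : NormedAlgebra ℂ (NCTorus θ) where
  norm_smul_le := norm_smul_le

instance : Star (NCTorus θ) := ⟨Completion.map (star : PreTorus θ → PreTorus θ)⟩

theorem continuous_star' : Continuous (star : NCTorus θ → NCTorus θ) := Completion.continuous_map

theorem ofPre_star (x : PreTorus θ) : ofPre θ (star x) = star (ofPre θ x) :=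
  (Completion.map_coe (starₗᵢ ℂ : PreTorus θ ≃ₗᵢ⋆[ℂ] PreTorus θ).isometry.uniformContinuous x).symm

instance : StarRing (NCTorus θ) where
  star_involutive x := by
    refine ind (P := fun x => star (star x) = x)
      (isClosed_eq (continuous_star'.comp continuous_star') continuous_id) (fun x => ?_) x
    simp only [← ofPre_star, star_star]
  star_mul x y := by
    refine ind₂ (P := fun x y => star (x * y) = star y * star x)
      (isClosed_eq (continuous_star'.comp continuous_mul)
        ((continuous_star'.comp continuous_snd).mul (continuous_star'.comp continuous_fst)))
      (fun x y => ?_) x y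
    simp only [← ofPre_star, ← ofPre_mul, star_mul]
  star_add x y := by
    refine ind₂ (P := fun x y => star (x + y) = star x + star y)
      (isClosed_eq (continuous_star'.comp continuous_add)
        ((continuous_star'.comp continuous_fst).add (continuous_star'.comp continuous_snd)))
      (fun x y => ?_) x y
    simp only [← ofPre_star, ← ofPre_add, star_add]

instance : StarModule ℂ (NCTorus θ) where
  star_smul c x := by
    refine ind (P := fun x => star (c • x) = star c • star x)
      (isClosed_eq (continuous_star'.comp (continuous_const_smul c))
        (continuous_star'.const_smul (star c))) (fun x => ?_) x
    simp only [← ofPre_star, ← ofPre_smul, star_smul]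

instance : CStarRing (NCTorus θ) where
  norm_mul_self_le x := by
    refine ind (P := fun x => ‖x‖ * ‖x‖ ≤ ‖star x * x‖)
      (isClosed_le (by fun_prop) (continuous_star'.mul continuous_id).norm) (fun x => ?_) x
    simp only [← ofPre_star, ← ofPre_mul, norm_ofPre]
    exact PreTorus.norm_mul_self_le x

instance : CStarAlgebra (NCTorus θ) where

/-- Words in the generators as unitary elements of the algebra. -/
def unitaryWord (θ : ℝ) : FreeGroup (Fin 2) →* unitary (NCTorus θ) where
  toFun g := ⟨ofPre θ (PreTorus.word θ g), by
    rw [Unitary.mem_iff, ← ofPre_star, PreTorus.star_word, ← ofPre_mul, ← ofPre_mul, ← map_mul,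
      ← map_mul]
    simp [ofPre_one]⟩
  map_one' := by ext; simp [ofPre_one]
  map_mul' x y := by ext; simp [ofPre_mul]

/-- The first canonical unitary generator. -/
def U (θ : ℝ) : unitary (NCTorus θ) := unitaryWord θ (FreeGroup.of 0)

/-- The second canonical unitary generator. -/
def V (θ : ℝ) : unitary (NCTorus θ) := unitaryWord θ (FreeGroup.of 1)

theorem V_mul_U (θ : ℝ) : (V θ * U θ : NCTorus θ) =
    Complex.exp (2 * Real.pi * Complex.I * θ) • (U θ * V θ : NCTorus θ) := by
  rw [← sub_eq_zero, ← norm_eq_zero]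
  change ‖ofPre θ (PreTorus.v θ) * ofPre θ (PreTorus.u θ) -
    _ • (ofPre θ (PreTorus.u θ) * ofPre θ (PreTorus.v θ))‖ = 0
  rw [← ofPre_mul, ← ofPre_mul, ← ofPre_smul, ← ofPre_sub, norm_ofPre, PreTorus.norm_rel]

/-- The homomorphism from the free `*`-algebra defined by two unitaries of `B`. -/
def preHom (θ : ℝ) {B : Type*} [CStarAlgebra B] (a b : unitary B) : PreTorus θ →ₐ[ℂ] B :=
  MonoidAlgebra.lift ℂ B (FreeGroup (Fin 2)) ((unitary B).subtype.comp (FreeGroup.lift ![a, b]))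

section preHom

variable {B : Type*} [CStarAlgebra B] (a b : unitary B)

theorem preHom_word (g : FreeGroup (Fin 2)) :
    preHom θ a b (PreTorus.word θ g) = (FreeGroup.lift ![a, b] g : unitary B) :=
  MonoidAlgebra.lift_of (R := ℂ) ((unitary B).subtype.comp (FreeGroup.lift ![a, b])) g

theorem preHom_star (x : PreTorus θ) : preHom θ a b (star x) = star (preHom θ a b x) := by
  induction x using PreTorus.induction with
  | h0 => simp
  | hadd x y hx hy => simp only [star_add, map_add, hx, hy]
  | hw c g =>
    simp only [star_smul, map_smul, PreTorus.star_word, preHom_word, map_inv]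
    rfl

theorem norm_preHom_le
    (hab : (b * a : B) = Complex.exp (2 * Real.pi * Complex.I * θ) • (a * b : B))
    (x : PreTorus θ) : ‖preHom θ a b x‖ ≤ ‖x‖ := by
  refine PreTorus.le_univNorm ⟨(normSeminorm ℂ B).comp (preHom θ a b).toLinearMap, ?_, ?_, ?_⟩ x
  · intro x y
    simpa using norm_mul_le (preHom θ a b x) (preHom θ a b y)
  · intro x
    simp [preHom_star, CStarRing.norm_star_mul_self, sq]
  · simp [PreTorus.u, PreTorus.v, preHom_word, hab]

end preHom

/-- The universal property that characterizes the algebra. -/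
theorem existsUnique_hom (θ : ℝ) {B : Type*} [CStarAlgebra B] (a b : unitary B)
    (hab : (b * a : B) = Complex.exp (2 * Real.pi * Complex.I * θ) • (a * b : B)) :
    ∃! φ : NCTorus θ →⋆ₐ[ℂ] B, φ (U θ) = a ∧ φ (V θ) = b := by
  have hu : UniformContinuous (preHom θ a b) :=
    AddMonoidHomClass.uniformContinuous_of_bound (preHom θ a b) 1
      (fun x => by simpa using norm_preHom_le a b hab x)
  let f : NCTorus θ → B := Completion.extension (preHom θ a b)
  have hf : Continuous f := Completion.continuous_extension
  have hfc (x : PreTorus θ) : f (ofPre θ x) = preHom θ a b x := Completion.extension_coe hu x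
  let φ : NCTorus θ →⋆ₐ[ℂ] B :=
    { toFun := f
      map_one' := by rw [← ofPre_one, hfc, map_one]
      map_zero' := by
        have : ofPre θ 0 = 0 := Completion.coe_zero
        rw [← this, hfc, map_zero]
      map_mul' := fun x y => by
        refine ind₂ (P := fun x y => f (x * y) = f x * f y)
          (isClosed_eq (hf.comp continuous_mul)
            ((hf.comp continuous_fst).mul (hf.comp continuous_snd))) (fun x y => ?_) x y
        simp only [← ofPre_mul, hfc, map_mul]
      map_add' := fun x y => by
        refine ind₂ (P := fun x y => f (x + y) = f x + f y)
          (isClosed_eq (hf.comp continuous_add)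
            ((hf.comp continuous_fst).add (hf.comp continuous_snd))) (fun x y => ?_) x y
        simp only [← ofPre_add, hfc, map_add]
      commutes' := fun c => by
        rw [Algebra.algebraMap_eq_smul_one, ← ofPre_one, ← ofPre_smul, hfc, map_smul, map_one,
          Algebra.algebraMap_eq_smul_one]
      map_star' := fun x => by
        refine ind (P := fun x => f (star x) = star (f x))
          (isClosed_eq (hf.comp continuous_star') hf.star) (fun x => ?_) x
        simp only [← ofPre_star, hfc, preHom_star] }
  refine ⟨φ, ⟨?_, ?_⟩, ?_⟩
  · exact (hfc _).trans ((preHom_word a b _).trans (by simp))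
  · exact (hfc _).trans ((preHom_word a b _).trans (by simp))
  · rintro ψ ⟨h1, h2⟩
    have hw : (Unitary.map (⟨(ψ : NCTorus θ →* B), map_star ψ⟩ : NCTorus θ →⋆* B)).toMonoidHom.comp (unitaryWord θ) = FreeGroup.lift ![a, b] := by
      refine FreeGroup.ext_hom _ _ fun i => ?_
      fin_cases i
      · exact Subtype.ext (h1.trans (by simp))
      · exact Subtype.ext (h2.trans (by simp))
    have hψ : Continuous ψ := AddMonoidHomClass.continuous_of_bound ψ 1
      (fun x => by simpa using NonUnitalStarAlgHom.norm_apply_le ψ x)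
    have key (x : PreTorus θ) : ψ (ofPre θ x) = preHom θ a b x := by
      induction x using PreTorus.induction with
      | h0 => rw [map_zero]; exact map_zero ψ
      | hadd x y hx hy => rw [ofPre_add, map_add, map_add, hx, hy]
      | hw c g =>
        rw [ofPre_smul, map_smul, map_smul, preHom_word, ← hw]
        rfl
    refine StarAlgHom.ext fun x => ?_
    refine ind (P := fun x => ψ x = f x) (isClosed_eq hψ hf) (fun x => ?_) x
    rw [key, hfc]

/-- For a continuous `1`-periodic `f : ℝ → ℂ`, the element `f(V)`, where `V` stands for
`e^{2 π i x}`: the continuous functional calculus sends `x ↦ e^{2 π i x}` to `V`. -/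
def evalV (θ : ℝ) (f : ℝ → ℂ) : NCTorus θ :=
  cfc (fun z : ℂ => f (Complex.arg z / (2 * Real.pi))) (V θ : NCTorus θ)

/-- `U^m f(V)` for an integer `m`. -/
def monomial (θ : ℝ) (m : ℤ) (f : ℝ → ℂ) : NCTorus θ :=
  ((U θ ^ m : unitary (NCTorus θ)) : NCTorus θ) * evalV θ f

/-- The canonical trace: the bounded linear functional with
`τ(∑_m U^m a_m(V)) = ∫_0^1 a_0(x) dx` for continuous periodic coefficients `a_m`. -/
def IsCanonicalTrace (τ : NCTorus θ →L[ℂ] ℂ) : Prop :=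
  ∀ (m : ℤ) (f : ℝ → ℂ), Continuous f → Function.Periodic f 1 →
    τ (monomial θ m f) = if m = 0 then ∫ x in (0 : ℝ)..1, f x else 0

/-- The `1`-periodic function `p_0` of a Power–Rieffel type projection with step `t` and
transition function `d` on `[0, ε]`. -/
def rieffelZero (t ε : ℝ) (d : ℝ → ℝ) (x : ℝ) : ℝ :=
  if Int.fract x ≤ ε then d (Int.fract x)
  else if Int.fract x < t then 1
  else if Int.fract x ≤ t + ε then 1 - d (Int.fract x - t)
  else 0

/-- The `1`-periodic function `p_M` of a Power–Rieffel type projection. -/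
def rieffelTop (ε : ℝ) (d : ℝ → ℝ) (x : ℝ) : ℝ :=
  if Int.fract x ≤ ε then Real.sqrt (d (Int.fract x) * (1 - d (Int.fract x))) else 0

/-- `p = U^{-M} p_{-M}(V) + p_0(V) + U^M p_M(V)` is of Power–Rieffel type of order `M`, with step the
fractional part of `M θ`; self-adjointness forces `p_{-M}(x) = conj (p_M (x - M θ))`. -/
def IsPowerRieffel (M : ℕ) (p : NCTorus θ) : Prop :=
  ∃ (ε : ℝ) (d : ℝ → ℝ), 0 < ε ∧ ε < Int.fract (M * θ) ∧ ε + Int.fract (M * θ) < 1 ∧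
    ContinuousOn d (Set.Icc 0 ε) ∧ d 0 = 0 ∧ d ε = 1 ∧
    (∀ x ∈ Set.Icc 0 ε, d x ∈ Set.Icc (0 : ℝ) 1) ∧
    p = monomial θ (-M) (fun x => (rieffelTop ε d (x - M * θ) : ℂ)) +
      monomial θ 0 (fun x => (rieffelZero (Int.fract (M * θ)) ε d x : ℂ)) +
      monomial θ M (fun x => (rieffelTop ε d x : ℂ))

end NCTorus


/-- Murray–von Neumann equivalence of projections in matrix algebras over `A`:
`p = v v^*` and `q = v^* v` for a rectangular matrix `v`. -/
def MvNEquiv {A m n : Type*} [Ring A] [StarRing A] [Fintype m] [Fintype n]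
    (p : Matrix m m A) (q : Matrix n n A) : Prop :=
  ∃ v : Matrix m n A, v * v.conjTranspose = p ∧ v.conjTranspose * v = q

namespace MvNEquiv

open Matrix

variable {A m n k l : Type*} [Ring A] [StarRing A] [Fintype m] [Fintype n] [Fintype k] [Fintype l]
  {p : Matrix m m A} {q : Matrix n n A} {r : Matrix k k A} {s : Matrix l l A}

theorem of_equiv (hp : IsStarProjection p) (e : n ≃ m) : MvNEquiv p (p.submatrix e e) := by
  have h1 : p * p = p := hp.isIdempotentElem
  have h2 : pᴴ = p := hp.isSelfAdjoint
  refine ⟨p.submatrix id e, ?_, ?_⟩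
  · rw [conjTranspose_submatrix, submatrix_mul_equiv, h2, h1, submatrix_id_id]
  · rw [conjTranspose_submatrix, h2, ← submatrix_mul p p e id e Function.bijective_id, h1]

theorem refl (hp : IsStarProjection p) : MvNEquiv p p := of_equiv hp (Equiv.refl m)

theorem symm (h : MvNEquiv p q) : MvNEquiv q p := by
  obtain ⟨v, h1, h2⟩ := h
  exact ⟨vᴴ, by rwa [conjTranspose_conjTranspose], by rwa [conjTranspose_conjTranspose]⟩

theorem trans (hp : IsStarProjection p) (hr : IsStarProjection r)
    (h : MvNEquiv p q) (h' : MvNEquiv q r) : MvNEquiv p r := by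
  obtain ⟨v, h1, h2⟩ := h
  obtain ⟨w, h3, h4⟩ := h'
  refine ⟨v * w, ?_, ?_⟩
  · rw [conjTranspose_mul, Matrix.mul_assoc, ← Matrix.mul_assoc w, h3, ← h2,
      Matrix.mul_assoc vᴴ, h1, ← Matrix.mul_assoc, h1]
    exact hp.isIdempotentElem
  · rw [conjTranspose_mul, Matrix.mul_assoc, ← Matrix.mul_assoc vᴴ, h2, ← h3,
      Matrix.mul_assoc w, h4, ← Matrix.mul_assoc, h4]
    exact hr.isIdempotentElem

theorem blocks (h : MvNEquiv p q) (h' : MvNEquiv r s) :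
    MvNEquiv (fromBlocks p 0 0 r) (fromBlocks q 0 0 s) := by
  obtain ⟨v, h1, h2⟩ := h
  obtain ⟨w, h3, h4⟩ := h'
  refine ⟨fromBlocks v 0 0 w, ?_, ?_⟩
  · rw [fromBlocks_conjTranspose, fromBlocks_multiply]
    simp [h1, h3]
  · rw [fromBlocks_conjTranspose, fromBlocks_multiply]
    simp [h2, h4]

theorem isStarProjection_blocks (hp : IsStarProjection p) (hq : IsStarProjection q) :
    IsStarProjection (fromBlocks p 0 0 q) := by
  constructor
  · rw [IsIdempotentElem, fromBlocks_multiply]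
    simp [hp.isIdempotentElem.eq, hq.isIdempotentElem.eq]
  · rw [IsSelfAdjoint, star_eq_conjTranspose, fromBlocks_conjTranspose]
    simp [← star_eq_conjTranspose, hp.isSelfAdjoint.star_eq, hq.isSelfAdjoint.star_eq]

theorem isStarProjection_submatrix (hp : IsStarProjection p) (e : n ≃ m) :
    IsStarProjection (p.submatrix e e) := by
  constructor
  · rw [IsIdempotentElem, submatrix_mul_equiv, hp.isIdempotentElem.eq]
  · rw [IsSelfAdjoint, star_eq_conjTranspose, conjTranspose_submatrix, ← star_eq_conjTranspose,
      hp.isSelfAdjoint.star_eq]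

end MvNEquiv

/-- A projection in the matrix algebra `M_n(A)`, for some `n`. -/
structure MatProj (A : Type*) [Ring A] [StarRing A] where
  size : ℕ
  mat : Matrix (Fin size) (Fin size) A
  isProj : IsStarProjection mat

namespace MatProj

open Matrix

variable {A : Type*} [Ring A] [StarRing A]

instance setoid (A : Type*) [Ring A] [StarRing A] : Setoid (MatProj A) where
  r p q := MvNEquiv p.mat q.mat
  iseqv := ⟨fun p => .refl p.isProj, .symm, fun {p _ r} h h' => .trans p.isProj r.isProj h h'⟩

/-- The block diagonal sum `p ⊕ q`. -/
def sum (p q : MatProj A) : MatProj A where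
  size := p.size + q.size
  mat := (fromBlocks p.mat 0 0 q.mat).submatrix finSumFinEquiv.symm finSumFinEquiv.symm
  isProj := MvNEquiv.isStarProjection_submatrix
    (MvNEquiv.isStarProjection_blocks p.isProj q.isProj) _

/-- The projection of size `0`. -/
def zero (A : Type*) [Ring A] [StarRing A] : MatProj A :=
  ⟨0, 0, ⟨mul_zero 0, star_zero _⟩⟩

/-- A projection of `A` as a `1 × 1` matrix. -/
def ofProj (p : A) (hp : IsStarProjection p) : MatProj A where
  size := 1
  mat := of fun _ _ => p
  isProj := by
    constructor
    · ext i j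
      simpa [Matrix.mul_apply] using hp.isIdempotentElem.eq
    · ext i j
      simpa using hp.isSelfAdjoint.star_eq

theorem blocks_proj (p q : MatProj A) : IsStarProjection (fromBlocks p.mat 0 0 q.mat) :=
  MvNEquiv.isStarProjection_blocks p.isProj q.isProj

theorem sum_equiv_blocks (p q : MatProj A) :
    MvNEquiv (p.sum q).mat (fromBlocks p.mat 0 0 q.mat) :=
  (MvNEquiv.of_equiv (p.blocks_proj q) _).symm

/-- `p ⊕ q` and `p' ⊕ q'` are equivalent as soon as the block matrices are. -/
theorem sum_equiv {p q p' q' : MatProj A}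
    (h : MvNEquiv (fromBlocks p.mat 0 0 q.mat) (fromBlocks p'.mat 0 0 q'.mat)) :
    p.sum q ≈ p'.sum q' :=
  .trans (p.sum q).isProj (p'.sum q').isProj (p.sum_equiv_blocks q)
    (.trans (p.blocks_proj q) (p'.sum q').isProj h (p'.sum_equiv_blocks q').symm)

theorem sum_congr {p p' q q' : MatProj A} (h : p ≈ p') (h' : q ≈ q') : p.sum q ≈ p'.sum q' :=
  sum_equiv (.blocks h h')

theorem sum_comm (p q : MatProj A) : p.sum q ≈ q.sum p := by
  refine sum_equiv ?_
  convert MvNEquiv.of_equiv (p.blocks_proj q) (Equiv.sumComm _ _)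
  ext (i | i) (j | j) <;> rfl

theorem sum_assoc (p q r : MatProj A) : (p.sum q).sum r ≈ p.sum (q.sum r) := by
  refine sum_equiv ?_
  have h1 := (p.sum_equiv_blocks q).blocks (.refl r.isProj)
  have h2 := (MvNEquiv.refl p.isProj).blocks (q.sum_equiv_blocks r)
  have hb := MvNEquiv.isStarProjection_blocks (p.blocks_proj q) r.isProj
  refine .trans (blocks_proj _ _) (blocks_proj _ _) h1 (.trans hb (blocks_proj _ _) ?_ h2.symm)
  convert MvNEquiv.of_equiv hb (Equiv.sumAssoc _ _ _).symm
  ext (i | i | i) (j | j | j) <;> rfl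

theorem zero_sum (p : MatProj A) : (zero A).sum p ≈ p := by
  refine .trans (sum _ _).isProj p.isProj (sum_equiv_blocks _ _) ?_
  convert MvNEquiv.of_equiv ((zero A).blocks_proj p) (Equiv.emptySum (Fin 0) (Fin p.size)).symm
  ext i j
  rfl

end MatProj

/-- Murray–von Neumann classes of projections in matrix algebras over `A`, under direct sum. -/
def ProjMonoid (A : Type*) [Ring A] [StarRing A] : Type _ := Quotient (MatProj.setoid A)

namespace ProjMonoid

variable {A : Type*} [Ring A] [StarRing A]

instance : Add (ProjMonoid A) :=
  ⟨Quotient.map₂ MatProj.sum fun _ _ h _ _ h' => MatProj.sum_congr h h'⟩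

instance : Zero (ProjMonoid A) := ⟨Quotient.mk _ (MatProj.zero A)⟩

instance : AddCommMonoid (ProjMonoid A) where
  add_assoc := by
    rintro ⟨p⟩ ⟨q⟩ ⟨r⟩
    exact Quotient.sound (MatProj.sum_assoc p q r)
  add_comm := by
    rintro ⟨p⟩ ⟨q⟩
    exact Quotient.sound (MatProj.sum_comm p q)
  zero_add := by
    rintro ⟨p⟩
    exact Quotient.sound (MatProj.zero_sum p)
  add_zero := by
    rintro ⟨p⟩
    exact Quotient.sound (Setoid.trans (MatProj.sum_comm p _) (MatProj.zero_sum p))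
  nsmul := nsmulRec

end ProjMonoid

/-- `K_0` of a unital `C^*`-algebra. -/
abbrev K0 (A : Type*) [CStarAlgebra A] : Type _ := Algebra.GrothendieckAddGroup (ProjMonoid A)

/-- The class `[p] ∈ K_0(A)` of a projection `p ∈ A`. -/
def K0.mk {A : Type*} [CStarAlgebra A] (p : A) (hp : IsStarProjection p) : K0 A :=
  Algebra.GrothendieckAddGroup.of (Quotient.mk (MatProj.setoid A) (MatProj.ofProj p hp))

end

/-!
The rotation algebra acts on `ℓ²(ℤ²)` by `U δ_{m,n} = δ_{m+1,n}` and
`V δ_{m,n} = e^{2 π i m θ} δ_{m,n+1}` (the regular representation `NCTorus.reg`). The trace is the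
vector functional `τ(a) = ⟨δ_0, a δ_0⟩`, so that `τ(U^m V^n) = 0` unless `m = n = 0`. The
commutator of `V` and `U` is the central scalar `e^{2 π i θ}`, hence every word in the generators is
a scalar multiple of some `U^m V^n`; on such products the identity `τ(xy) = τ(yx)` is a comparison
of exponents, and it extends to the whole algebra by density (`NCTorus.trace_mul_comm`). The formula
`τ(U^m f(V)) = δ_{m,0} ∫ f` holds for the characters `f(x) = e^{2 π i n x}` and extends to all
continuous periodic `f`, because trigonometric polynomials are uniformly dense
(`NCTorus.isCanonicalTrace_trace`).

A trace is constant on Murray–von Neumann classes of projections in matrix algebras and additive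
under direct sums, so it induces a homomorphism `K_0 → ℂ`, and projections with different traces
have different classes (`K0.mk_ne_mk`).

Conjugation by `U` translates functions of `V` by `θ` (`NCTorus.evalV_mul_U_zpow`), which turns
`p ^ 2 = p` for `p = U^{-M} p_{-M}(V) + p_0(V) + U^M p_M(V)` into three pointwise identities, one for
each of the Fourier coefficients of order `0`, `M`, `2M`
(`NCTorus.isStarProjection_of_relations`); the Power–Rieffel functions satisfy them by a case
distinction on fractional parts. The trace of `p` is `∫ p_0`, where the falling edge of `p_0`
complements the rising one, so it is the fractional part of `M θ`. For irrational `θ` these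
are pairwise different, which gives infinitely many classes in `K_0`.
-/

noncomputable section

/-! ### Weighted permutations of `ℓ²` -/

/-- The unitary of `ℓ²(ι)` that maps the basis vector `δ_j` to `c (σ j) δ_{σ j}`, for a permutation
`σ` of `ι` and phases `c`. -/
def lpWeightedPerm {ι : Type*} (σ : Equiv.Perm ι) (c : ι → Circle) :
    lp (fun _ : ι => ℂ) 2 ≃ₗᵢ[ℂ] lp (fun _ : ι => ℂ) 2 :=
  have mem (σ : Equiv.Perm ι) (c : ι → Circle) (f : lp (fun _ : ι => ℂ) 2) :
      Memℓp (fun k => (c k : ℂ) * f (σ k)) 2 := by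
    have h := (memℓp_gen_iff (p := 2) (by norm_num)).1 (lp.memℓp f)
    refine (memℓp_gen_iff (by norm_num)).2 ?_
    simpa [Function.comp_def, Circle.norm_coe] using h.comp_injective σ.injective
  LinearIsometryEquiv.ofSurjective
    { toFun := fun f => ⟨fun k => (c k : ℂ) * f (σ.symm k), mem σ.symm c f⟩
      map_add' := fun f g => by
        ext k
        exact mul_add _ _ _
      map_smul' := fun a f => by
        ext k
        exact mul_left_comm _ _ _
      norm_map' := fun f => by
        rw [lp.norm_eq_tsum_rpow (by norm_num), lp.norm_eq_tsum_rpow (by norm_num)]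
        congr 1
        simpa [Circle.norm_coe] using σ.symm.tsum_eq (fun k => ‖f k‖ ^ 2) }
    fun f => by
      refine ⟨⟨fun k => ((c (σ k))⁻¹ : Circle) * f (σ k), mem σ (fun k => (c (σ k))⁻¹) f⟩, ?_⟩
      ext k
      change (c k : ℂ) * (((c (σ (σ.symm k)))⁻¹ : Circle) * f (σ (σ.symm k))) = f k
      rw [σ.apply_symm_apply, ← mul_assoc, ← Circle.coe_mul, mul_inv_cancel, Circle.coe_one, one_mul]

theorem lpWeightedPerm_apply {ι : Type*} (σ : Equiv.Perm ι) (c : ι → Circle)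
    (f : lp (fun _ : ι => ℂ) 2) (k : ι) : lpWeightedPerm σ c f k = c k * f (σ.symm k) := rfl

theorem lpWeightedPerm_single {ι : Type*} [DecidableEq ι] (σ : Equiv.Perm ι) (c : ι → Circle)
    (j : ι) : lpWeightedPerm σ c (lp.single 2 j 1) = (c (σ j) : ℂ) • lp.single 2 (σ j) 1 := by
  ext k
  rw [lpWeightedPerm_apply, lp.coeFn_smul, Pi.smul_apply, lp.single_apply, lp.single_apply]
  by_cases h : k = σ j
  · subst h
    simp
  · rw [Pi.single_eq_of_ne h, Pi.single_eq_of_ne (fun h' => h (by simp [← h'])), mul_zero,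
      smul_zero]

namespace NCTorus

variable {θ : ℝ}

/-! ### The regular representation and the canonical trace -/

/-- The Hilbert space `ℓ²(ℤ²)` of the regular representation. -/
abbrev L2 : Type := lp (fun _ : ℤ × ℤ => ℂ) 2

/-- The basis vector `δ_{(m, n)}`. -/
def delta (m n : ℤ) : L2 := lp.single 2 (m, n) 1

theorem inner_delta (k l m n : ℤ) :
    inner ℂ (delta k l) (delta m n) = if m = k ∧ n = l then 1 else 0 := by
  rw [delta, lp.inner_single_left, delta, lp.single_apply, Pi.single_apply]
  by_cases h : m = k ∧ n = l
  · simp [h]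
  · rw [if_neg h, if_neg (by rintro ⟨⟩; simp at h), inner_zero_right]

/-- `δ_{(m, n)} ↦ δ_{(m + 1, n)}`. -/
def regU : unitary (L2 →L[ℂ] L2) :=
  Unitary.linearIsometryEquiv.symm (lpWeightedPerm (Equiv.addRight (1, 0)) 1)

/-- `δ_{(m, n)} ↦ e^{2 π i m θ} δ_{(m, n + 1)}`. -/
def regV (θ : ℝ) : unitary (L2 →L[ℂ] L2) :=
  Unitary.linearIsometryEquiv.symm
    (lpWeightedPerm (Equiv.addRight (0, 1)) fun k => Circle.exp (2 * Real.pi * θ * k.1))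

theorem regU_apply (f : L2) (k : ℤ × ℤ) : (regU : L2 →L[ℂ] L2) f k = f (k - (1, 0)) := by
  change (1 : ℂ) * f (k + -(1, 0)) = _
  rw [one_mul, sub_eq_add_neg]

theorem regV_apply (f : L2) (k : ℤ × ℤ) : (regV θ : L2 →L[ℂ] L2) f k =
    Complex.exp (2 * Real.pi * θ * k.1 * Complex.I) * f (k - (0, 1)) := by
  change (Circle.exp (2 * Real.pi * θ * k.1) : ℂ) * f (k + -(0, 1)) = _
  rw [sub_eq_add_neg, Circle.coe_exp]
  push_cast
  rfl

theorem regV_mul_regU : (regV θ * regU : L2 →L[ℂ] L2) =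
    Complex.exp (2 * Real.pi * Complex.I * θ) • (regU * regV θ : L2 →L[ℂ] L2) := by
  ext f k
  change (regV θ : L2 →L[ℂ] L2) ((regU : L2 →L[ℂ] L2) f) k =
    Complex.exp (2 * Real.pi * Complex.I * θ) * (regU : L2 →L[ℂ] L2) ((regV θ : L2 →L[ℂ] L2) f) k
  rw [regV_apply, regU_apply, regU_apply, regV_apply, ← mul_assoc, ← Complex.exp_add,
    sub_right_comm]
  congr 2
  simp only [Prod.fst_sub, Int.cast_sub, Int.cast_one]
  ring

/-- The regular representation of the rotation algebra on `ℓ²(ℤ²)`. -/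
def reg (θ : ℝ) : NCTorus θ →⋆ₐ[ℂ] (L2 →L[ℂ] L2) :=
  (existsUnique_hom θ regU (regV θ) regV_mul_regU).choose

theorem reg_U : reg θ (U θ) = regU :=
  (existsUnique_hom θ regU (regV θ) regV_mul_regU).choose_spec.1.1

theorem reg_V : reg θ (V θ) = regV θ :=
  (existsUnique_hom θ regU (regV θ) regV_mul_regU).choose_spec.1.2

/-- If a unitary shifts a bi-infinite sequence, so do its powers. -/
theorem zpow_apply_of_apply {H : Type*} [NormedAddCommGroup H] [InnerProductSpace ℂ H]
    [CompleteSpace H] (W : unitary (H →L[ℂ] H)) (e : ℤ → H)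
    (h : ∀ k, (W : H →L[ℂ] H) (e k) = e (k + 1)) (m k : ℤ) :
    ((W ^ m : unitary (H →L[ℂ] H)) : H →L[ℂ] H) (e k) = e (k + m) := by
  have hinv (k : ℤ) : ((W⁻¹ : unitary (H →L[ℂ] H)) : H →L[ℂ] H) (e k) = e (k - 1) := by
    have h1 := h (k - 1)
    rw [sub_add_cancel] at h1
    rw [← h1, ← mul_apply_eq_comp, ← Submonoid.coe_mul, inv_mul_cancel]
    rfl
  induction m with
  | zero => simp
  | succ m ih =>
    rw [zpow_add_one, (Commute.refl W).zpow_left m, Submonoid.coe_mul,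
      mul_apply_eq_comp, ih, h, add_assoc]
  | pred m ih =>
    rw [zpow_sub_one, ((Commute.refl W).zpow_left _).inv_right, Submonoid.coe_mul,
      mul_apply_eq_comp, ih, hinv, add_sub_assoc]

theorem map_coe_zpow {A B : Type*} [CStarAlgebra A] [CStarAlgebra B] (φ : A →⋆ₐ[ℂ] B)
    (u : unitary A) (w : unitary B) (h : φ u = w) (m : ℤ) :
    φ ((u ^ m : unitary A) : A) = ((w ^ m : unitary B) : B) := by
  have h1 : Unitary.map (⟨(φ : A →* B), map_star φ⟩ : A →⋆* B) u = w := Subtype.ext h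
  have h2 := map_zpow (Unitary.map (⟨(φ : A →* B), map_star φ⟩ : A →⋆* B)).toMonoidHom u m
  exact (congrArg Subtype.val h2).trans (congrArg (fun w : unitary B => ((w ^ m : unitary B) : B)) h1)

theorem reg_zpow_mul_zpow_delta (m n : ℤ) :
    reg θ ((U θ ^ m * V θ ^ n : unitary (NCTorus θ)) : NCTorus θ) (delta 0 0) = delta m n := by
  rw [Submonoid.coe_mul, map_mul, map_coe_zpow _ _ _ reg_U, map_coe_zpow _ _ _ reg_V,
    mul_apply_eq_comp, zpow_apply_of_apply _ (fun k => delta 0 k),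
    zpow_apply_of_apply _ (fun k => delta k (0 + n)), zero_add, zero_add]
  · intro k
    change lpWeightedPerm _ _ _ = _
    rw [delta, lpWeightedPerm_single]
    simp [delta]
  · intro k
    change lpWeightedPerm _ _ _ = _
    rw [delta, lpWeightedPerm_single]
    simp [delta]

/-- The vector functional `a ↦ ⟨δ_0, a δ_0⟩` of the regular representation. -/
def trace (θ : ℝ) : NCTorus θ →L[ℂ] ℂ :=
  (innerSL ℂ (delta 0 0)) ∘L (ContinuousLinearMap.apply ℂ L2 (delta 0 0)) ∘L
    LinearMap.mkContinuous (reg θ).toAlgHom.toLinearMap 1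
      fun x => by simpa using NonUnitalStarAlgHom.norm_apply_le (reg θ) x

theorem trace_apply (a : NCTorus θ) :
    trace θ a = inner ℂ (delta 0 0) (reg θ a (delta 0 0)) := rfl

theorem trace_zpow_mul_zpow (m n : ℤ) :
    trace θ ((U θ ^ m * V θ ^ n : unitary (NCTorus θ)) : NCTorus θ) =
      if m = 0 ∧ n = 0 then 1 else 0 := by
  rw [trace_apply, reg_zpow_mul_zpow_delta, inner_delta]

/-! ### Normal form of words, and the trace property -/

/-- Powers of two group elements with a central commutator. -/
theorem zpow_mul_zpow_of_mul_eq {G : Type*} [Group G] {a b z : G} (ha : Commute z a)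
    (hb : Commute z b) (h : b * a = z * (a * b)) (m n : ℤ) :
    b ^ n * a ^ m = z ^ (n * m) * (a ^ m * b ^ n) := by
  have h1 : SemiconjBy a (z * b) b := by
    rw [SemiconjBy, h, ← mul_assoc, ← ha.eq, mul_assoc]
  have h2 : SemiconjBy (b ^ n) a (z ^ n * a) := by
    have := (h1.zpow_right n).eq
    rw [hb.mul_zpow, ← mul_assoc, ← (ha.zpow_left n).eq] at this
    exact this.symm
  have := (h2.zpow_right m).eq
  rwa [(ha.zpow_left n).mul_zpow, ← zpow_mul, mul_assoc] at this

/-- The commutator of the generators, which is the scalar `e^{2 π i θ}`. -/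
def phase (θ : ℝ) : unitary (NCTorus θ) := V θ * U θ * (V θ)⁻¹ * (U θ)⁻¹

theorem V_mul_U_eq_phase : V θ * U θ = phase θ * (U θ * V θ) := by
  rw [phase]
  group

theorem coe_phase : (phase θ : NCTorus θ) = Complex.exp (2 * Real.pi * Complex.I * θ) • 1 := by
  have h : (V θ * U θ * ((V θ)⁻¹ * (U θ)⁻¹ : unitary (NCTorus θ)) : NCTorus θ) = phase θ := by
    rw [phase, mul_assoc (V θ * U θ)]
    rfl
  rw [← h, V_mul_U, smul_mul_assoc]
  congr 1
  change ((U θ * V θ * ((V θ)⁻¹ * (U θ)⁻¹) : unitary (NCTorus θ)) : NCTorus θ) = 1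
  simp [mul_assoc]

theorem commute_phase (u : unitary (NCTorus θ)) : Commute (phase θ) u := by
  refine Subtype.ext ?_
  change (phase θ * u : NCTorus θ) = u * phase θ
  rw [coe_phase, smul_one_mul, mul_smul_one]

theorem V_zpow_mul_U_zpow (m n : ℤ) :
    V θ ^ n * U θ ^ m = phase θ ^ (n * m) * (U θ ^ m * V θ ^ n) :=
  zpow_mul_zpow_of_mul_eq (commute_phase _) (commute_phase _) V_mul_U_eq_phase m n

theorem phase_zpow_mul (j : ℤ) (u : unitary (NCTorus θ)) :
    ((phase θ ^ j * u : unitary (NCTorus θ)) : NCTorus θ) =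
      Complex.exp (2 * Real.pi * Complex.I * θ) ^ j • (u : NCTorus θ) := by
  have key (j : ℤ) : ((phase θ ^ j : unitary (NCTorus θ)) : NCTorus θ) =
      Complex.exp (2 * Real.pi * Complex.I * θ) ^ j • 1 := by
    have hne := Complex.exp_ne_zero (2 * Real.pi * Complex.I * θ)
    have hinv : (((phase θ)⁻¹ : unitary (NCTorus θ)) : NCTorus θ) =
        (Complex.exp (2 * Real.pi * Complex.I * θ))⁻¹ • 1 := by
      have h : (phase θ * ((phase θ)⁻¹ : unitary (NCTorus θ)) : NCTorus θ) = 1 :=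
        congrArg Subtype.val (mul_inv_cancel (phase θ))
      rw [coe_phase, smul_one_mul] at h
      rw [← h, inv_smul_smul₀ hne]
    induction j with
    | zero => simp
    | succ j ih =>
      rw [zpow_add_one, zpow_add_one₀ hne, Submonoid.coe_mul, ih, coe_phase, smul_mul_smul_comm,
        one_mul]
    | pred j ih =>
      rw [zpow_sub_one, zpow_sub_one₀ hne, Submonoid.coe_mul, ih, hinv, smul_mul_smul_comm,
        one_mul]
  rw [Submonoid.coe_mul, key, smul_one_mul]

theorem mul_normal_form (i j k l m n : ℤ) :
    phase θ ^ i * (U θ ^ k * V θ ^ l) * (phase θ ^ j * (U θ ^ m * V θ ^ n)) =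
      phase θ ^ (i + j + l * m) * (U θ ^ (k + m) * V θ ^ (l + n)) := by
  have hc (j : ℤ) (u : unitary (NCTorus θ)) : phase θ ^ j * u = u * phase θ ^ j :=
    ((commute_phase u).zpow_left j).eq
  calc _ = phase θ ^ i * phase θ ^ j * (U θ ^ k * (V θ ^ l * U θ ^ m) * V θ ^ n) := by
        simp only [hc j, mul_assoc]
    _ = phase θ ^ i * phase θ ^ j * phase θ ^ (l * m) *
          (U θ ^ k * U θ ^ m * (V θ ^ l * V θ ^ n)) := by
        rw [V_zpow_mul_U_zpow]
        simp only [hc (l * m), mul_assoc]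
    _ = _ := by simp only [zpow_add]

theorem unitaryWord_normal_form (g : FreeGroup (Fin 2)) :
    ∃ j m n : ℤ, unitaryWord θ g = phase θ ^ j * (U θ ^ m * V θ ^ n) := by
  have hof (i : Fin 2) : ∃ m n : ℤ, unitaryWord θ (FreeGroup.of i) = U θ ^ m * V θ ^ n := by
    fin_cases i
    · exact ⟨1, 0, by simp [U]⟩
    · exact ⟨0, 1, by simp [V]⟩
  induction g using FreeGroup.induction_on with
  | C1 => exact ⟨0, 0, 0, by simp⟩
  | of i =>
    obtain ⟨m, n, h⟩ := hof i
    exact ⟨0, m, n, by rw [h, zpow_zero, one_mul]⟩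
  | inv_of i _ =>
    obtain ⟨m, n, h⟩ := hof i
    refine ⟨-n * -m, -m, -n, ?_⟩
    rw [map_inv, h, mul_inv_rev, ← zpow_neg, ← zpow_neg, V_zpow_mul_U_zpow]
  | mul g h hg hh =>
    obtain ⟨i, k, l, hg⟩ := hg
    obtain ⟨j, m, n, hh⟩ := hh
    exact ⟨_, _, _, by rw [map_mul, hg, hh, mul_normal_form]⟩

theorem trace_mul_comm (x y : NCTorus θ) : trace θ (x * y) = trace θ (y * x) := by
  have hw (g h : FreeGroup (Fin 2)) :
      trace θ (ofPre θ (PreTorus.word θ g * PreTorus.word θ h)) =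
        trace θ (ofPre θ (PreTorus.word θ h * PreTorus.word θ g)) := by
    rw [← map_mul, ← map_mul]
    change trace θ (unitaryWord θ (g * h)) = trace θ (unitaryWord θ (h * g))
    obtain ⟨i, k, l, hg⟩ := unitaryWord_normal_form (θ := θ) g
    obtain ⟨j, m, n, hh⟩ := unitaryWord_normal_form (θ := θ) h
    simp only [map_mul (unitaryWord θ), hg, hh, mul_normal_form, phase_zpow_mul, map_smul,
      trace_zpow_mul_zpow]
    by_cases hz : k + m = 0 ∧ l + n = 0
    · obtain ⟨rfl, rfl⟩ : m = -k ∧ n = -l := by omega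
      have e : i + j + l * -k = j + i + -l * k := by ring
      simp only [add_neg_cancel, neg_add_cancel, and_self, e]
    · rw [if_neg hz, if_neg (by omega), smul_zero, smul_zero]
  refine ind₂ (P := fun x y => trace θ (x * y) = trace θ (y * x))
    (isClosed_eq ((trace θ).continuous.comp continuous_mul)
      ((trace θ).continuous.comp (continuous_snd.mul continuous_fst))) (fun x y => ?_) x y
  rw [← ofPre_mul, ← ofPre_mul]
  induction x using PreTorus.induction with
  | h0 => rw [zero_mul, mul_zero]
  | hadd x x' hx hx' => simp only [add_mul, mul_add, ofPre_add, map_add, hx, hx']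
  | hw c g =>
    induction y using PreTorus.induction with
    | h0 => rw [zero_mul, mul_zero]
    | hadd x x' hx hx' => simp only [add_mul, mul_add, ofPre_add, map_add, hx, hx']
    | hw d h =>
      rw [smul_mul_smul_comm, smul_mul_smul_comm, ofPre_smul, ofPre_smul, map_smul, map_smul, hw,
        mul_comm c]

end NCTorus

/-! ### Traces and `K_0` -/

section K0

open Matrix

variable {A : Type*} [CStarAlgebra A] (τ : A →L[ℂ] ℂ)

theorem MvNEquiv.trace_map_eq (hτ : ∀ x y, τ (x * y) = τ (y * x)) {m n : Type*} [Fintype m]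
    [Fintype n] {p : Matrix m m A} {q : Matrix n n A} (h : MvNEquiv p q) :
    (p.map τ).trace = (q.map τ).trace := by
  obtain ⟨v, rfl, rfl⟩ := h
  simp only [Matrix.trace, diag_apply, map_apply, mul_apply, map_sum, hτ (vᴴ _ _)]
  exact Finset.sum_comm

/-- The additive map `[p] ↦ ∑ᵢ τ(pᵢᵢ)` induced by a trace on classes of projections. -/
def ProjMonoid.traceHom (hτ : ∀ x y, τ (x * y) = τ (y * x)) : ProjMonoid A →+ ℂ where
  toFun := Quotient.lift (fun p => (p.mat.map τ).trace) fun _ _ h => h.trace_map_eq τ hτ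
  map_zero' := by
    change (((0 : Matrix (Fin 0) (Fin 0) A)).map τ).trace = 0
    simp
  map_add' := by
    rintro ⟨p⟩ ⟨q⟩
    change ((p.sum q).mat.map τ).trace = (p.mat.map τ).trace + (q.mat.map τ).trace
    rw [(p.sum_equiv_blocks q).trace_map_eq τ hτ, fromBlocks_map]
    simp [Matrix.trace]

/-- A trace separates `K_0`-classes of projections on which it takes different values. -/
theorem K0.mk_ne_mk (hτ : ∀ x y, τ (x * y) = τ (y * x)) {p q : A} (hp : IsStarProjection p)
    (hq : IsStarProjection q) (hpq : τ p ≠ τ q) : K0.mk p hp ≠ K0.mk q hq := by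
  have key (p : A) (hp : IsStarProjection p) :
      Algebra.GrothendieckAddGroup.lift (ProjMonoid.traceHom τ hτ) (K0.mk p hp) = τ p := by
    have h := DFunLike.congr_fun (Algebra.GrothendieckAddGroup.lift.symm_apply_apply
      (ProjMonoid.traceHom τ hτ)) (Quotient.mk (MatProj.setoid A) (MatProj.ofProj p hp))
    refine Eq.trans h ?_
    change (((of fun _ _ => p : Matrix (Fin 1) (Fin 1) A)).map τ).trace = τ p
    simp [Matrix.trace]
  intro h
  rw [← key p hp, ← key q hq, h] at hpq
  exact hpq rfl

end K0

namespace NCTorus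

variable {θ : ℝ}

/-! ### Functional calculus in `V` -/

theorem coe_exp_two_pi (x : ℝ) : Complex.exp (2 * Real.pi * Complex.I * x) =
    Complex.exp ((2 * Real.pi * x : ℝ) * Complex.I) := by
  congr 1
  push_cast
  ring

theorem periodic_arg_exp {f : ℝ → ℂ} (hf : Function.Periodic f 1) (x : ℝ) :
    f (Complex.arg (Complex.exp (2 * Real.pi * Complex.I * x)) / (2 * Real.pi)) = f x := by
  rw [coe_exp_two_pi, Complex.arg_exp_mul_I, toIocMod, sub_div,
    mul_div_cancel_left₀ x Real.two_pi_pos.ne', zsmul_eq_mul,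
    mul_div_cancel_right₀ _ Real.two_pi_pos.ne']
  simpa using hf.sub_zsmul_eq (x := x) (toIocDiv Real.two_pi_pos (-Real.pi) (2 * Real.pi * x))

theorem eq_exp_arg_of_mem_sphere {z : ℂ} (hz : z ∈ Metric.sphere (0 : ℂ) 1) :
    z = Complex.exp (2 * Real.pi * Complex.I * (Complex.arg z / (2 * Real.pi) : ℝ)) := by
  rw [coe_exp_two_pi, mul_div_cancel₀ _ Real.two_pi_pos.ne']
  have := Complex.norm_mul_exp_arg_mul_I z
  rw [mem_sphere_zero_iff_norm.1 hz, Complex.ofReal_one, one_mul] at this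
  exact this.symm

theorem continuousOn_comp_arg {f : ℝ → ℂ} (hc : Continuous f) (hf : Function.Periodic f 1) :
    ContinuousOn (fun z : ℂ => f (Complex.arg z / (2 * Real.pi))) (Metric.sphere 0 1) := by
  have hper : Function.Periodic (fun x => f (x / (2 * Real.pi))) (2 * Real.pi) := by
    intro x
    change f _ = f _
    rw [add_div, div_self Real.two_pi_pos.ne', hf]
  have hg : Continuous (hper.lift : Real.Angle → ℂ) :=
    QuotientAddGroup.isQuotientMap_mk _ |>.continuous_iff.2
      (hc.comp (continuous_id.div_const (2 * Real.pi)))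
  intro z hz
  have hz0 : z ≠ 0 := by
    rintro rfl
    simp at hz
  exact (hg.continuousAt.comp (Complex.continuousAt_arg_coe_angle hz0)).continuousWithinAt

section

variable {f g : ℝ → ℂ}

theorem continuousOn_spectrum (hc : Continuous f) (hf : Function.Periodic f 1) :
    ContinuousOn (fun z : ℂ => f (Complex.arg z / (2 * Real.pi)))
      (spectrum ℂ (V θ : NCTorus θ)) :=
  (continuousOn_comp_arg hc hf).mono (Unitary.spectrum_subset_circle (V θ))

theorem evalV_mul (hc : Continuous f) (hf : Function.Periodic f 1) (gc : Continuous g)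
    (hg : Function.Periodic g 1) :
    evalV θ f * evalV θ g = evalV θ (fun x => f x * g x) :=
  (cfc_mul _ _ _ (continuousOn_spectrum hc hf) (continuousOn_spectrum gc hg)).symm

theorem evalV_add (hc : Continuous f) (hf : Function.Periodic f 1) (gc : Continuous g)
    (hg : Function.Periodic g 1) :
    evalV θ f + evalV θ g = evalV θ (fun x => f x + g x) :=
  (cfc_add _ _ _ (continuousOn_spectrum hc hf) (continuousOn_spectrum gc hg)).symm

theorem evalV_smul (c : ℂ) (hc : Continuous f) (hf : Function.Periodic f 1) :
    evalV θ (fun x => c * f x) = c • evalV θ f :=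
  cfc_const_mul _ _ _ (continuousOn_spectrum hc hf)

theorem star_evalV : star (evalV θ f) = evalV θ (fun x => star (f x)) :=
  (cfc_star _ _).symm

theorem norm_evalV_le {C : ℝ} (hC : 0 ≤ C) (h : ∀ x, ‖f x‖ ≤ C) : ‖evalV θ f‖ ≤ C :=
  norm_cfc_le hC fun _ _ => h _

theorem evalV_exp (n : ℤ) : evalV θ (fun x => Complex.exp (2 * Real.pi * Complex.I * n * x)) =
    ((V θ ^ n : unitary (NCTorus θ)) : NCTorus θ) := by
  have h1 : ((V θ ^ n : unitary (NCTorus θ)) : NCTorus θ) =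
      ((Unitary.toUnits (V θ) ^ n : (NCTorus θ)ˣ) : NCTorus θ) := by
    rw [← map_zpow]
    rfl
  have hn : IsStarNormal ((Unitary.toUnits (V θ) : (NCTorus θ)ˣ) : NCTorus θ) :=
    inferInstanceAs (IsStarNormal (V θ : NCTorus θ))
  rw [h1, ← cfc_zpow (R := ℂ) (Unitary.toUnits (V θ)) n hn]
  refine cfc_congr fun z hz => ?_
  conv_rhs =>
    rw [eq_exp_arg_of_mem_sphere (Unitary.spectrum_subset_circle (V θ) hz), ← Complex.exp_int_mul]
  change Complex.exp _ = _
  congr 1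
  ring

/-- Conjugation by `U^m` translates functions of `V` by `m θ`. -/
theorem evalV_mul_U_zpow (hc : Continuous f) (hf : Function.Periodic f 1) (m : ℤ) :
    evalV θ f * ((U θ ^ m : unitary (NCTorus θ)) : NCTorus θ) =
      ((U θ ^ m : unitary (NCTorus θ)) : NCTorus θ) * evalV θ (fun x => f (x + m * θ)) := by
  set u : unitary (NCTorus θ) := U θ ^ m with hu
  set r : ℂ := Complex.exp (2 * Real.pi * Complex.I * (m * θ : ℝ)) with hr
  let φ : NCTorus θ →⋆ₐ[ℂ] NCTorus θ := (Unitary.conjStarAlgAut ℂ (NCTorus θ) (star u)).toStarAlgHom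
  have hφ (x : NCTorus θ) : φ x = star (u : NCTorus θ) * x * u :=
    Unitary.conjStarAlgAut_star_apply (S := ℂ) u x
  have hV : φ (V θ) = r • (V θ : NCTorus θ) := by
    have h := V_zpow_mul_U_zpow (θ := θ) m 1
    rw [one_mul, zpow_one, ← hu] at h
    have h' := congrArg (fun w : unitary (NCTorus θ) => (w : NCTorus θ)) h
    simp only [phase_zpow_mul] at h'
    simp only [Submonoid.coe_mul] at h'
    rw [hφ, mul_assoc, h', mul_smul_comm, ← mul_assoc, Unitary.coe_star_mul_self, one_mul,
      ← Complex.exp_int_mul, hr]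
    congr 2
    push_cast
    ring
  have hrn : ‖r‖ = 1 := by
    rw [hr, coe_exp_two_pi, Complex.norm_exp_ofReal_mul_I]
  have hφn : IsStarNormal (φ (V θ)) := IsStarNormal.map φ (V θ : NCTorus θ)
  have key : φ (evalV θ f) = evalV θ (fun x => f (x + m * θ)) := by
    have hφc : Continuous φ := by
      have : (φ : NCTorus θ → NCTorus θ) = fun x => star (u : NCTorus θ) * x * u := funext hφ
      rw [this]
      fun_prop
    have himg : ContinuousOn (fun z : ℂ => f (Complex.arg z / (2 * Real.pi)))
        ((fun z => r * z) '' spectrum ℂ (V θ : NCTorus θ)) := by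
      refine (continuousOn_comp_arg hc hf).mono ?_
      rintro _ ⟨z, hz, rfl⟩
      have hz' := Unitary.spectrum_subset_circle (V θ) hz
      simpa [hrn] using hz'
    rw [evalV, StarAlgHom.map_cfc φ _ _ (continuousOn_spectrum hc hf) hφc
      (inferInstanceAs (IsStarNormal (V θ : NCTorus θ))) hφn, hV,
      ← cfc_comp_const_mul r (fun z : ℂ => f (Complex.arg z / (2 * Real.pi))) (V θ : NCTorus θ) himg]
    refine cfc_congr fun z hz => ?_
    have hz' := Unitary.spectrum_subset_circle (V θ) hz
    change f (Complex.arg (r * z) / _) = f _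
    conv_lhs => rw [eq_exp_arg_of_mem_sphere hz', hr, ← Complex.exp_add]
    rw [← mul_add, ← Complex.ofReal_add, periodic_arg_exp hf, add_comm]
  rw [← key, hφ, mul_assoc (star _), ← mul_assoc, Unitary.mul_star_self_of_mem u.2, one_mul]

theorem monomial_mul (hc : Continuous f) (hf : Function.Periodic f 1) (gc : Continuous g)
    (hg : Function.Periodic g 1) (m n : ℤ) :
    monomial θ m f * monomial θ n g = monomial θ (m + n) (fun x => f (x + n * θ) * g x) := by
  have hfn : Function.Periodic (fun x => f (x + n * θ)) 1 := hf.add_const _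
  rw [monomial, monomial, monomial, mul_assoc, ← mul_assoc (evalV θ f), evalV_mul_U_zpow hc hf,
    mul_assoc, evalV_mul (by fun_prop) hfn gc hg, ← mul_assoc, zpow_add]
  rfl

theorem monomial_add (hc : Continuous f) (hf : Function.Periodic f 1) (gc : Continuous g)
    (hg : Function.Periodic g 1) (m : ℤ) :
    monomial θ m f + monomial θ m g = monomial θ m (fun x => f x + g x) := by
  rw [monomial, monomial, monomial, ← mul_add, evalV_add hc hf gc hg]

theorem monomial_zero (m : ℤ) : monomial θ m (fun _ => 0) = 0 := by
  rw [monomial, evalV]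
  simp

theorem star_monomial (hc : Continuous f) (hf : Function.Periodic f 1) (m : ℤ) :
    star (monomial θ m f) = monomial θ (-m) (fun x => star (f (x - m * θ))) := by
  have hs : Function.Periodic (fun x => star (f x)) 1 := fun x => by
    change star _ = star _
    rw [hf]
  have h : star ((U θ ^ m : unitary (NCTorus θ)) : NCTorus θ) =
      ((U θ ^ (-m) : unitary (NCTorus θ)) : NCTorus θ) := by
    rw [zpow_neg]
    rfl
  rw [monomial, star_mul, star_evalV, h, evalV_mul_U_zpow (by fun_prop) hs, monomial]
  simp only [Int.cast_neg, neg_mul, sub_eq_add_neg]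

end

/-! ### The trace formula -/

theorem integral_exp_two_pi (n : ℤ) :
    ∫ x in (0 : ℝ)..1, Complex.exp (2 * Real.pi * Complex.I * n * x) = if n = 0 then 1 else 0 := by
  split_ifs with h
  · simp [h]
  · have hn : (2 * Real.pi * Complex.I * n : ℂ) ≠ 0 :=
      mul_ne_zero Complex.two_pi_I_ne_zero (Int.cast_ne_zero.2 h)
    rw [integral_exp_mul_complex hn, Complex.ofReal_one, mul_one, Complex.ofReal_zero, mul_zero,
      mul_comm, Complex.exp_int_mul_two_pi_mul_I, Complex.exp_zero, sub_self, zero_div]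

/-- The map `F ↦ F(V)` on continuous functions on the circle, as a bounded linear map. -/
def evalVCLM (θ : ℝ) : C(UnitAddCircle, ℂ) →L[ℂ] NCTorus θ :=
  have hc (F : C(UnitAddCircle, ℂ)) : Continuous (fun x : ℝ => F x) :=
    F.continuous.comp (AddCircle.continuous_mk' 1)
  have hp (F : C(UnitAddCircle, ℂ)) : Function.Periodic (fun x : ℝ => F x) 1 := fun x =>
    congrArg F (AddCircle.coe_add_period 1 x)
  LinearMap.mkContinuous
    { toFun := fun F => evalV θ fun x => F x
      map_add' := fun F G => (evalV_add (hc F) (hp F) (hc G) (hp G)).symm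
      map_smul' := fun c F => evalV_smul c (hc F) (hp F) } 1
    fun F => by
      rw [one_mul]
      exact norm_evalV_le (norm_nonneg F) fun x => F.norm_coe_le_norm x

/-- The integral over a period, as a bounded linear functional. -/
def integralCLM : C(UnitAddCircle, ℂ) →L[ℂ] ℂ :=
  have hi (F : C(UnitAddCircle, ℂ)) :
      IntervalIntegrable (fun x : ℝ => F x) MeasureTheory.volume 0 1 :=
    (F.continuous.comp (AddCircle.continuous_mk' 1)).intervalIntegrable 0 1
  LinearMap.mkContinuous
    { toFun := fun F => ∫ x in (0 : ℝ)..1, F x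
      map_add' := fun F G => intervalIntegral.integral_add (hi F) (hi G)
      map_smul' := fun c F => intervalIntegral.integral_const_mul c _ } 1
    fun F => by
      have := intervalIntegral.norm_integral_le_of_norm_le_const (a := 0) (b := 1)
        (f := fun x : ℝ => F x) (C := ‖F‖) fun x _ => F.norm_coe_le_norm x
      simpa using this

/-- It suffices to compare both sides on the characters of the circle, whose span is dense. -/
theorem isCanonicalTrace_trace (θ : ℝ) : IsCanonicalTrace (trace θ) := by
  intro m f hc hf
  let L : C(UnitAddCircle, ℂ) →L[ℂ] ℂ := trace θ ∘L
    (ContinuousLinearMap.mul ℂ (NCTorus θ) ((U θ ^ m : unitary (NCTorus θ)) : NCTorus θ)) ∘L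
    evalVCLM θ
  let R : C(UnitAddCircle, ℂ) →L[ℂ] ℂ := (if m = 0 then (1 : ℂ) else 0) • integralCLM
  have hLR : L = R := by
    refine ContinuousLinearMap.ext_on (s := Set.range (fourier (T := 1))) ?_ ?_
    · rw [dense_iff_closure_eq, ← Submodule.topologicalClosure_coe, span_fourier_closure_eq_top]
      rfl
    · rintro _ ⟨n, rfl⟩
      have hn : (fun x : ℝ => fourier n (x : UnitAddCircle)) =
          fun x : ℝ => Complex.exp (2 * Real.pi * Complex.I * n * x) := by
        funext x
        rw [fourier_coe_apply, Complex.ofReal_one, div_one]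
      have h1 : L (fourier n) = if m = 0 ∧ n = 0 then 1 else 0 := by
        change trace θ (_ * evalV θ (fun x : ℝ => fourier n (x : UnitAddCircle))) = _
        rw [hn, evalV_exp, ← Submonoid.coe_mul, trace_zpow_mul_zpow]
      have h2 : R (fourier n) = (if m = 0 then 1 else 0) * if n = 0 then 1 else 0 := by
        change _ * (∫ x in (0 : ℝ)..1, fourier n (x : UnitAddCircle)) = _
        rw [hn, integral_exp_two_pi]
      rw [h1, h2, ite_and, mul_ite, mul_one, mul_zero]
      split_ifs <;> rfl
  have hF : Continuous (hf.lift : UnitAddCircle → ℂ) :=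
    QuotientAddGroup.isQuotientMap_mk _ |>.continuous_iff.2 hc
  have h := DFunLike.congr_fun hLR ⟨hf.lift, hF⟩
  refine Eq.trans h ?_
  change (if m = 0 then (1 : ℂ) else 0) * (∫ x in (0 : ℝ)..1, f x) = _
  split_ifs <;> simp

/-! ### The Power–Rieffel projections -/

theorem fract_add_cases (x s : ℝ) :
    (Int.fract (x + s) = Int.fract x + Int.fract s ∧ Int.fract x + Int.fract s < 1) ∨
      (Int.fract (x + s) = Int.fract x + Int.fract s - 1 ∧ 1 ≤ Int.fract x + Int.fract s) := by
  have hx0 := Int.fract_nonneg x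
  have hs0 := Int.fract_nonneg s
  have hx1 := Int.fract_lt_one x
  have hs1 := Int.fract_lt_one s
  rcases lt_or_ge (Int.fract x + Int.fract s) 1 with h | h
  · refine Or.inl ⟨Int.fract_eq_iff.2 ⟨by linarith, h, ⌊x⌋ + ⌊s⌋, ?_⟩, h⟩
    simp only [Int.fract]
    push_cast
    ring
  · refine Or.inr ⟨Int.fract_eq_iff.2 ⟨by linarith, by linarith, ⌊x⌋ + ⌊s⌋ + 1, ?_⟩, h⟩
    simp only [Int.fract]
    push_cast
    ring

section

variable {ε s : ℝ} {d : ℝ → ℝ}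

/-- The translates of `p_M` by `0` and `-M θ` have disjoint supports. -/
theorem rieffelTop_mul_rieffelTop (hs : ε < Int.fract s) (hs1 : ε + Int.fract s < 1) (x : ℝ) :
    rieffelTop ε d (x + s) * rieffelTop ε d x = 0 := by
  have hx := Int.fract_nonneg x
  simp only [rieffelTop]
  rcases fract_add_cases x s with ⟨h, h'⟩ | ⟨h, h'⟩ <;> rw [h]
  · rw [if_neg (by linarith), zero_mul]
  · rw [if_neg (c := Int.fract x ≤ ε) (by linarith), mul_zero]

/-- On the support of `p_M` one has `p_0(x) + p_0(x + M θ) = 1`. -/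
theorem rieffelTop_mul_rieffelZero (hs : ε < Int.fract s)
    (hs1 : ε + Int.fract s < 1) (x : ℝ) :
    rieffelZero (Int.fract s) ε d (x + s) * rieffelTop ε d x +
      rieffelTop ε d x * rieffelZero (Int.fract s) ε d x = rieffelTop ε d x := by
  have hx := Int.fract_nonneg x
  by_cases hxε : Int.fract x ≤ ε
  · rcases fract_add_cases x s with ⟨h, h'⟩ | ⟨h, h'⟩
    · have h1 : rieffelZero (Int.fract s) ε d (x + s) = 1 - d (Int.fract x) := by
        rw [rieffelZero, h, if_neg (by linarith), if_neg (by linarith), if_pos (by linarith),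
          add_sub_cancel_right]
      have h2 : rieffelZero (Int.fract s) ε d x = d (Int.fract x) := by
        rw [rieffelZero, if_pos hxε]
      rw [h1, h2]
      ring
    · linarith
  · simp [rieffelTop, hxε]

/-- The zeroth Fourier coefficient of `p ^ 2` is `p_0`. On the two transition intervals this is
`d ^ 2 + d (1 - d) = d` and its mirror image. -/
theorem rieffelTop_sq_add (hs : ε < Int.fract s) (hs1 : ε + Int.fract s < 1)
    (hd : ∀ x ∈ Set.Icc 0 ε, d x ∈ Set.Icc (0 : ℝ) 1) (x : ℝ) :
    rieffelTop ε d x * rieffelTop ε d x +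
      rieffelZero (Int.fract s) ε d x * rieffelZero (Int.fract s) ε d x +
      rieffelTop ε d (x - s) * rieffelTop ε d (x - s) = rieffelZero (Int.fract s) ε d x := by
  have hsq (y : ℝ) (h0 : 0 ≤ y) (h1 : y ≤ ε) :
      √(d y * (1 - d y)) * √(d y * (1 - d y)) = d y * (1 - d y) :=
    Real.mul_self_sqrt (mul_nonneg (hd y ⟨h0, h1⟩).1 (sub_nonneg.2 (hd y ⟨h0, h1⟩).2))
  have hx0 := Int.fract_nonneg x
  have hx1 := Int.fract_lt_one x
  have hy0 := Int.fract_nonneg (x - s)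
  have hcases := fract_add_cases (x - s) s
  rw [sub_add_cancel] at hcases
  by_cases h1 : Int.fract x ≤ ε
  · rw [rieffelZero, if_pos h1, rieffelTop, if_pos h1, rieffelTop, if_neg, hsq _ hx0 h1]
    · ring
    · rcases hcases with ⟨h, h'⟩ | ⟨h, h'⟩ <;> linarith
  rw [rieffelTop, if_neg h1]
  by_cases h2 : Int.fract x < Int.fract s
  · rw [rieffelZero, if_neg h1, if_pos h2, rieffelTop, if_neg]
    · ring
    · rcases hcases with ⟨h, h'⟩ | ⟨h, h'⟩ <;> linarith
  have hy : Int.fract (x - s) = Int.fract x - Int.fract s := by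
    rcases hcases with ⟨h, h'⟩ | ⟨h, h'⟩
    · linarith
    · linarith [Int.fract_lt_one (x - s)]
  by_cases h3 : Int.fract x ≤ Int.fract s + ε
  · rw [rieffelZero, if_neg h1, if_neg h2, if_pos h3, rieffelTop, hy, if_pos (by linarith),
      hsq _ (by linarith) (by linarith)]
    ring
  · rw [rieffelZero, if_neg h1, if_neg h2, if_neg h3, rieffelTop, hy, if_neg (by linarith)]
    ring

theorem periodic_rieffelTop : Function.Periodic (fun x => (rieffelTop ε d x : ℂ)) 1 := by
  intro x
  simp only [rieffelTop, Int.fract_add_one]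

theorem periodic_rieffelZero (t : ℝ) :
    Function.Periodic (fun x => (rieffelZero t ε d x : ℂ)) 1 := by
  intro x
  simp only [rieffelZero, Int.fract_add_one]

theorem continuous_rieffelTop (hε : 0 < ε) (hε1 : ε < 1) (hc : ContinuousOn d (Set.Icc 0 ε))
    (h0 : d 0 = 0) (h1 : d ε = 1) : Continuous (rieffelTop ε d) := by
  have h : ContinuousOn (fun a => if a ≤ ε then √(d a * (1 - d a)) else 0) (Set.Icc (0 : ℝ) 1) := by
    refine ContinuousOn.if ?_ ?_ continuousOn_const
    · rintro a ⟨-, ha⟩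
      obtain rfl : a = ε := by simpa using frontier_le_subset_eq continuous_id continuous_const ha
      simp [h1]
    · rw [(isClosed_le (f := fun a : ℝ => a) continuous_id continuous_const).closure_eq]
      have hc' := hc.mono (s := Set.Icc 0 ε) (t := Set.Icc 0 1 ∩ {a | a ≤ ε})
        fun a ha => ⟨ha.1.1, ha.2⟩
      exact (hc'.mul (continuousOn_const.sub hc')).sqrt
  exact h.comp_fract'' (by simp [h0, hε.le, hε1.not_ge])

theorem continuous_rieffelZero {t : ℝ} (hε : 0 < ε) (hεt : ε < t) (hεt1 : ε + t < 1)
    (hc : ContinuousOn d (Set.Icc 0 ε)) (h0 : d 0 = 0) (h1 : d ε = 1) :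
    Continuous (rieffelZero t ε d) := by
  have h : ContinuousOn (fun a => if a ≤ ε then d a else if a < t then 1 else
      if a ≤ t + ε then 1 - d (a - t) else 0) (Set.Icc (0 : ℝ) 1) := by
    -- The function is the product of the rising and the falling transition.
    have e : ∀ a ∈ Set.Icc (0 : ℝ) 1, (if a ≤ ε then d a else if a < t then 1 else
        if a ≤ t + ε then 1 - d (a - t) else 0) =
        Set.IccExtend hε.le (Set.domRestrict (Set.Icc 0 ε) d) a *
          (1 - Set.IccExtend hε.le (Set.domRestrict (Set.Icc 0 ε) d) (a - t)) := by
      intro a ha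
      have ext_of_le (b : ℝ) (hb : b ≤ 0) :
          Set.IccExtend hε.le (Set.domRestrict (Set.Icc 0 ε) d) b = 0 := by
        rw [Set.IccExtend_of_le_left _ _ hb]
        exact h0
      have ext_of_ge (b : ℝ) (hb : ε ≤ b) :
          Set.IccExtend hε.le (Set.domRestrict (Set.Icc 0 ε) d) b = 1 := by
        rw [Set.IccExtend_of_right_le _ _ hb]
        exact h1
      have ext_of_mem (b : ℝ) (hb : b ∈ Set.Icc 0 ε) :
          Set.IccExtend hε.le (Set.domRestrict (Set.Icc 0 ε) d) b = d b :=
        Set.IccExtend_of_mem _ _ hb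
      split_ifs with i1 i2 i3
      · rw [ext_of_mem a ⟨ha.1, i1⟩, ext_of_le _ (by linarith), sub_zero, mul_one]
      · rw [ext_of_ge a (by linarith), ext_of_le _ (by linarith), sub_zero, mul_one]
      · rw [ext_of_ge a (by linarith), ext_of_mem _ ⟨by linarith, by linarith⟩, one_mul]
      · rw [ext_of_ge (a - t) (by linarith), sub_self, mul_zero]
    have hE : Continuous (Set.IccExtend hε.le (Set.domRestrict (Set.Icc 0 ε) d)) :=
      (continuousOn_iff_continuous_domRestrict.1 hc).Icc_extend'
    exact ContinuousOn.congr (by fun_prop) e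
  exact h.comp_fract'' (by
    rw [if_pos hε.le, h0, if_neg (by linarith), if_neg (by linarith), if_neg (by linarith)])

/-- The falling transition of `p_0` compensates the area missing in the rising one. -/
theorem integral_rieffelZero {t : ℝ} (hε : 0 < ε) (hεt : ε < t) (hεt1 : ε + t < 1)
    (hc : ContinuousOn d (Set.Icc 0 ε)) (h0 : d 0 = 0) (h1 : d ε = 1) :
    ∫ x in (0 : ℝ)..1, rieffelZero t ε d x = t := by
  have hi (a b : ℝ) : IntervalIntegrable (rieffelZero t ε d) MeasureTheory.volume a b :=
    (continuous_rieffelZero hε hεt hεt1 hc h0 h1).intervalIntegrable a b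
  have hfr (x : ℝ) (hx0 : 0 ≤ x) (hx1 : x < 1) : Int.fract x = x := Int.fract_eq_self.2 ⟨hx0, hx1⟩
  have e1 : ∫ x in (0 : ℝ)..ε, rieffelZero t ε d x = ∫ x in (0 : ℝ)..ε, d x := by
    refine intervalIntegral.integral_congr_Ioo_of_le hε.le fun x hx => ?_
    rw [rieffelZero, hfr x hx.1.le (by linarith [hx.2]), if_pos hx.2.le]
  have e2 : ∫ x in ε..t, rieffelZero t ε d x = ∫ x in ε..t, (1 : ℝ) := by
    refine intervalIntegral.integral_congr_Ioo_of_le hεt.le fun x hx => ?_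
    rw [rieffelZero, hfr x (by linarith [hx.1]) (by linarith [hx.2]), if_neg hx.1.not_ge,
      if_pos hx.2]
  have e3 : ∫ x in t..t + ε, rieffelZero t ε d x = ∫ x in t..t + ε, (1 - d (x - t)) := by
    refine intervalIntegral.integral_congr_Ioo_of_le (by linarith) fun x hx => ?_
    rw [rieffelZero, hfr x (by linarith [hx.1]) (by linarith [hx.2]), if_neg (by linarith [hx.1]),
      if_neg hx.1.not_gt, if_pos hx.2.le]
  have e4 : ∫ x in (t + ε)..1, rieffelZero t ε d x = ∫ x in (t + ε)..1, (0 : ℝ) := by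
    refine intervalIntegral.integral_congr_Ioo_of_le (by linarith) fun x hx => ?_
    rw [rieffelZero, hfr x (by linarith [hx.1]) (by linarith [hx.2]), if_neg (by linarith [hx.1]),
      if_neg (by linarith [hx.1]), if_neg hx.1.not_ge]
  have hdi : IntervalIntegrable d MeasureTheory.volume 0 ε :=
    ContinuousOn.intervalIntegrable (by rwa [Set.uIcc_of_le hε.le])
  rw [← intervalIntegral.integral_add_adjacent_intervals (hi 0 ε) (hi ε 1),
    ← intervalIntegral.integral_add_adjacent_intervals (hi ε t) (hi t 1),
    ← intervalIntegral.integral_add_adjacent_intervals (hi t (t + ε)) (hi (t + ε) 1), e1, e2, e3,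
    e4, intervalIntegral.integral_comp_sub_right (fun x => 1 - d x), sub_self, add_sub_cancel_left,
    intervalIntegral.integral_sub intervalIntegrable_const hdi]
  simp

/-- The Power–Rieffel element built from functions `f`, `g` is a projection as soon as `f`, `g`
satisfy the relations that say that the Fourier coefficients of `p ^ 2` and of `p` agree. -/
theorem isStarProjection_of_relations {f g : ℝ → ℝ} (fc : Continuous f)
    (hf : Function.Periodic (fun x => (f x : ℂ)) 1) (gc : Continuous g)
    (hg : Function.Periodic (fun x => (g x : ℂ)) 1) (M : ℕ)
    (h2 : ∀ x, g (x + M * θ) * g x = 0) (h1 : ∀ x, f (x + M * θ) * g x + g x * f x = g x)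
    (h0 : ∀ x, g x * g x + f x * f x + g (x - M * θ) * g (x - M * θ) = f x) :
    IsStarProjection (monomial θ (-M) (fun x => (g (x - M * θ) : ℂ)) +
      monomial θ 0 (fun x => (f x : ℂ)) + monomial θ M (fun x => (g x : ℂ))) := by
  have hfc : Continuous fun x => (f x : ℂ) := by fun_prop
  have hgc : Continuous fun x => (g x : ℂ) := by fun_prop
  have hgsc : Continuous fun x => (g (x - M * θ) : ℂ) := by fun_prop
  have hgs : Function.Periodic (fun x => (g (x - M * θ) : ℂ)) 1 := hg.sub_const _
  -- Normalize the translations that `monomial_mul` and `star_monomial` produce.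
  have a1 (x : ℝ) : x + ((-(M : ℤ) : ℤ) : ℝ) * θ = x - M * θ := by push_cast; ring
  have a2 (x : ℝ) : x - ((-(M : ℤ) : ℤ) : ℝ) * θ = x + M * θ := by push_cast; ring
  have a3 (x : ℝ) : x + ((M : ℤ) : ℝ) * θ = x + M * θ := by push_cast; ring
  have a4 (x : ℝ) : x - ((M : ℤ) : ℝ) * θ = x - M * θ := by push_cast; ring
  have a5 (x : ℝ) : x + ((0 : ℤ) : ℝ) * θ = x := by simp
  have a6 (x : ℝ) : x - ((0 : ℤ) : ℝ) * θ = x := by simp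
  have hprod {k l : ℝ → ℝ} (kc : Continuous fun x => (k x : ℂ))
      (hk : Function.Periodic (fun x => (k x : ℂ)) 1) (lc : Continuous fun x => (l x : ℂ))
      (hl : Function.Periodic (fun x => (l x : ℂ)) 1) (m n : ℤ) :
      monomial θ m (fun x => (k x : ℂ)) * monomial θ n (fun x => (l x : ℂ)) =
        monomial θ (m + n) fun x => ((k (x + n * θ) * l x : ℝ) : ℂ) := by
    rw [monomial_mul kc hk lc hl]
    simp only [Complex.ofReal_mul]
  have hsum {k l : ℝ → ℝ} (kc : Continuous k)
      (hk : Function.Periodic (fun x => (k x : ℂ)) 1) (lc : Continuous l)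
      (hl : Function.Periodic (fun x => (l x : ℂ)) 1) (m : ℤ) :
      monomial θ m (fun x => (k x : ℂ)) + monomial θ m (fun x => (l x : ℂ)) =
        monomial θ m fun x => ((k x + l x : ℝ) : ℂ) := by
    rw [monomial_add (by fun_prop) hk (by fun_prop) hl]
    simp only [Complex.ofReal_add]
  have hmulp {k l : ℝ → ℝ} (a b : ℝ) (hk : Function.Periodic (fun x => (k x : ℂ)) 1)
      (hl : Function.Periodic (fun x => (l x : ℂ)) 1) :
      Function.Periodic (fun x => ((k (x + a) * l (x + b) : ℝ) : ℂ)) 1 := by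
    simp only [Complex.ofReal_mul]
    exact (hk.add_const a).mul (hl.add_const b)
  constructor
  · have hAA : monomial θ (-M) (fun x => (g (x - M * θ) : ℂ)) *
        monomial θ (-M) (fun x => (g (x - M * θ) : ℂ)) = 0 := by
      rw [hprod hgsc hgs hgsc hgs, ← monomial_zero (-M + -M)]
      congr 1
      funext x
      have := h2 (x - M * θ - M * θ)
      rw [sub_add_cancel] at this
      rw [a1, mul_comm, this, Complex.ofReal_zero]
    have hCC : monomial θ M (fun x => (g x : ℂ)) * monomial θ M (fun x => (g x : ℂ)) = 0 := by
      rw [hprod hgc hg hgc hg, ← monomial_zero (M + M)]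
      congr 1
      funext x
      rw [a3, h2, Complex.ofReal_zero]
    have hBC : monomial θ 0 (fun x => (f x : ℂ)) * monomial θ M (fun x => (g x : ℂ)) +
        monomial θ M (fun x => (g x : ℂ)) * monomial θ 0 (fun x => (f x : ℂ)) =
        monomial θ M (fun x => (g x : ℂ)) := by
      rw [hprod hfc hf hgc hg, hprod hgc hg hfc hf, zero_add, add_zero]
      simp only [a3, a5]
      rw [hsum (by fun_prop) (by simpa using hmulp (M * θ) 0 hf hg) (by fun_prop)
        (by simpa using hmulp 0 0 hg hf)]
      simp only [h1]
    have hAB : monomial θ (-M) (fun x => (g (x - M * θ) : ℂ)) * monomial θ 0 (fun x => (f x : ℂ)) +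
        monomial θ 0 (fun x => (f x : ℂ)) * monomial θ (-M) (fun x => (g (x - M * θ) : ℂ)) =
        monomial θ (-M) (fun x => (g (x - M * θ) : ℂ)) := by
      rw [hprod hgsc hgs hfc hf, hprod hfc hf hgsc hgs, zero_add, add_zero]
      simp only [a1, a5]
      rw [hsum (by fun_prop) (by simpa [sub_eq_add_neg] using hmulp (-(M * θ)) 0 hg hf)
        (by fun_prop) (by simpa [sub_eq_add_neg] using hmulp (-(M * θ)) (-(M * θ)) hf hg)]
      congr 1
      funext x
      have := h1 (x - M * θ)
      rw [sub_add_cancel] at this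
      exact congrArg Complex.ofReal (by linarith)
    have hB : monomial θ (-M) (fun x => (g (x - M * θ) : ℂ)) * monomial θ M (fun x => (g x : ℂ)) +
        monomial θ 0 (fun x => (f x : ℂ)) * monomial θ 0 (fun x => (f x : ℂ)) +
        monomial θ M (fun x => (g x : ℂ)) * monomial θ (-M) (fun x => (g (x - M * θ) : ℂ)) =
        monomial θ 0 (fun x => (f x : ℂ)) := by
      rw [hprod hgsc hgs hgc hg, hprod hfc hf hfc hf, hprod hgc hg hgsc hgs, neg_add_cancel,
        add_neg_cancel, add_zero]
      simp only [a1, a3, a5, add_sub_cancel_right]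
      have p1 : Function.Periodic (fun x => ((g x * g x : ℝ) : ℂ)) 1 := by
        simpa using hmulp 0 0 hg hg
      have p2 : Function.Periodic (fun x => ((f x * f x : ℝ) : ℂ)) 1 := by
        simpa using hmulp 0 0 hf hf
      rw [hsum (by fun_prop) p1 (by fun_prop) p2, hsum (by fun_prop) _ (by fun_prop)
        (by simpa [sub_eq_add_neg] using hmulp (-(M * θ)) (-(M * θ)) hg hg)]
      · simp only [h0]
      · simp only [Complex.ofReal_add]
        exact p1.add p2
    rw [IsIdempotentElem]
    generalize monomial θ (-M) (fun x => (g (x - M * θ) : ℂ)) = a at *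
    generalize monomial θ M (fun x => (g x : ℂ)) = c at *
    generalize monomial θ 0 (fun x => (f x : ℂ)) = b at *
    calc (a + b + c) * (a + b + c) = a * a + c * c + (a * b + b * a) +
          (a * c + b * b + c * a) + (b * c + c * b) := by noncomm_ring
      _ = a + b + c := by rw [hAA, hCC, hAB, hB, hBC, add_zero, zero_add]
  · rw [IsSelfAdjoint, star_add, star_add, star_monomial hgsc hgs, star_monomial hfc hf,
      star_monomial hgc hg]
    simp only [a2, a4, a6, add_sub_cancel_right, neg_neg, neg_zero, RCLike.star_def,
      Complex.conj_ofReal]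
    abel

/-- A projection of Power–Rieffel type exists for each order, with linear transition function. -/
theorem exists_isPowerRieffel (hθ : Irrational θ) (M : ℕ) (hM : 1 ≤ M) :
    ∃ p : NCTorus θ, IsStarProjection p ∧ IsPowerRieffel M p ∧
      trace θ p = (((M : ℝ) * θ - ⌊(M : ℝ) * θ⌋ : ℝ) : ℂ) := by
  have hM0 : M ≠ 0 := by omega
  have ht0 : 0 < Int.fract (M * θ) := by
    refine (Int.fract_nonneg _).lt_of_ne fun h => ?_
    exact (hθ.natCast_mul hM0).ne_int ⌊M * θ⌋ (by linarith [Int.floor_add_fract (M * θ)])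
  have ht1 := Int.fract_lt_one (M * θ)
  obtain ⟨ε, hε, hεt, hεt1⟩ : ∃ ε : ℝ, 0 < ε ∧ ε < Int.fract (M * θ) ∧
      ε + Int.fract (M * θ) < 1 := by
    obtain ⟨ε, hε, h⟩ := exists_between (lt_min ht0 (sub_pos.2 ht1))
    exact ⟨ε, hε, (lt_min_iff.1 h).1, by linarith [(lt_min_iff.1 h).2]⟩
  set d : ℝ → ℝ := fun x => x / ε with hd
  have dc : ContinuousOn d (Set.Icc 0 ε) := by fun_prop
  have d0 : d 0 = 0 := zero_div ε
  have d1 : d ε = 1 := div_self hε.ne'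
  have dm : ∀ x ∈ Set.Icc 0 ε, d x ∈ Set.Icc (0 : ℝ) 1 := fun x hx =>
    ⟨div_nonneg hx.1 hε.le, (div_le_one hε).2 hx.2⟩
  have gc := continuous_rieffelTop hε (by linarith) dc d0 d1
  have fc := continuous_rieffelZero hε hεt hεt1 dc d0 d1
  have hg : Function.Periodic (fun x => (rieffelTop ε d x : ℂ)) 1 := periodic_rieffelTop
  have hf := periodic_rieffelZero (ε := ε) (d := d) (Int.fract (M * θ))
  refine ⟨_, isStarProjection_of_relations fc hf gc hg M (rieffelTop_mul_rieffelTop hεt hεt1)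
    (rieffelTop_mul_rieffelZero hεt hεt1) (rieffelTop_sq_add hεt hεt1 dm),
    ⟨ε, d, hε, hεt, hεt1, dc, d0, d1, dm, rfl⟩, ?_⟩
  have hτ := isCanonicalTrace_trace θ
  rw [map_add, map_add, hτ (-M) _ (by fun_prop) (hg.sub_const _), hτ 0 _ (by fun_prop) hf,
    hτ M _ (by fun_prop) hg, if_neg (by omega), if_pos rfl, if_neg (by omega), zero_add, add_zero,
    intervalIntegral.integral_ofReal, integral_rieffelZero hε hεt hεt1 dc d0 d1]
  rfl

end

end NCTorus

theorem theorem1 (θ : ℝ) (hθ : Irrational θ) (h01 : θ ∈ Set.Ico (0 : ℝ) 1) :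
    (Set.range fun p : {p : NCTorus θ // IsStarProjection p} => K0.mk p.1 p.2).Infinite ∧
    ∃ τ : NCTorus θ →L[ℂ] ℂ, NCTorus.IsCanonicalTrace τ ∧
      (∀ (p q : NCTorus θ) (hp : IsStarProjection p) (hq : IsStarProjection q),
        τ p ≠ τ q → K0.mk p hp ≠ K0.mk q hq) ∧
      ∀ M : ℕ, 1 ≤ M → ∃ p : NCTorus θ, IsStarProjection p ∧ NCTorus.IsPowerRieffel M p ∧
        τ p = (((M : ℝ) * θ - ⌊(M : ℝ) * θ⌋ : ℝ) : ℂ) := by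
  have hsep (p q : NCTorus θ) (hp : IsStarProjection p) (hq : IsStarProjection q)
      (h : NCTorus.trace θ p ≠ NCTorus.trace θ q) : K0.mk p hp ≠ K0.mk q hq :=
    K0.mk_ne_mk _ NCTorus.trace_mul_comm hp hq h
  refine ⟨?_, NCTorus.trace θ, NCTorus.isCanonicalTrace_trace θ, hsep,
    NCTorus.exists_isPowerRieffel hθ⟩
  choose p hp _ hτ using fun M : ℕ => NCTorus.exists_isPowerRieffel hθ (M + 1) M.succ_pos
  refine Set.infinite_of_injective_forall_mem (f := fun M => K0.mk (p M) (hp M)) ?_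
    fun M => ⟨⟨p M, hp M⟩, rfl⟩
  intro M N h
  by_contra hMN
  refine hsep _ _ _ _ (fun h' => ?_) h
  rw [hτ, hτ, Complex.ofReal_inj] at h'
  -- Equal fractional parts make `(M - N) θ` an integer.
  refine (hθ.intCast_mul (m := (M : ℤ) - N) (by omega)).ne_int
    (⌊((M + 1 : ℕ) : ℝ) * θ⌋ - ⌊((N + 1 : ℕ) : ℝ) * θ⌋) ?_
  push_cast at h' ⊢
  linarith

end
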